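/- **Setting.** Write $\partial_1=\partial/\partial x_1$ and $\widetilde f(n_1)=f(n_1+1)$. Let $x_1,x_3,x_5,\dots\in\mathbb R$, $n_1,n_2,\dots\in\mathbb Z$, $n\in\mathbb Z$, $p_1,p_2,\dots\in\mathbb C$, and $$\rho_n(k)=e^{\sum_{j\ge0}k^{2j+1}x_{2j+1}}\prod_{i\ge1}\Big(\frac{p_i+k}{p_i-k}\Big)^{n_i}k^n,\qquad \sigma_n(k')=e^{\sum_{j\ge0}k'^{2j+1}x_{2j+1}}\prod_{i\ge1}\Big(\frac{p_i+k'}{p_i-k'}\Big)^{n_i}(-k')^{-n}.$$ Let $\zeta$ be a complex measure (a density times a $\sigma$-finite positive measure) on a measurable domain $D\subset\mathbb C^2$, such that for all $(k,k'),(l,l')\in D$ one has $k+l'\ne0$, $k,k'\neq0$, $k,k'\ne\pm p_i$, and the above sums and products converge unconditionally. Let $\mathbf C_n=\iint_D d\zeta(k,k')\,\rho_n(k)\,\mathbf c(k)\,{}^{t}\mathbf c(k')\,\sigma_n(k')$ with $\mathbf c(k)=(k^i)_{i\in\mathbb Z}$, and let $\boldsymbol\Omega$ be the infinite matrix of the Cauchy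 kernel, ${}^{t}\mathbf c(k')\,\boldsymbol\Omega\,\mathbf c(k)=\frac1{k+k'}$. The tau function $\tau_n=\det(1+\boldsymbol\Omega\mathbf C_n)$ is understood as its expansion in principal minors, in which $\boldsymbol\Omega$ enters only through these pairings: $$\tau_n=\sum_{m\ge0}\frac1{m!}\int_{D^m}\det\Big[\frac1{k_a+k_b'}\Big]_{a,b=1}^m\prod_{a=1}^m\rho_n(k_a)\sigma_n(k_a')\,d\zeta(k_a,k_a').$$ Fix the variables other than $x_1,n_1,n$, and assume that for all $x_1$ in an open set $J\subset\mathbb R$ and all $n_1,n\in\mathbb Z$ this expansion, together with its first and second termwise $x_1$-derivatives, converges absolutely. **Theorem.** 1. Let $\boldsymbol\Omega=(\Omega_{ij})_{i,j\in\mathbb Z}$ be any complex matrix such that for all $k,k'$ occurring in $D$ (as first, respectively second, components, independently of each other) the series $\sum_{i,j}k'^i\,\Omega_{ij}\,k^j$ converges absolutely, with sum of absolute values bounded uniformly in $k,k'$, and has the sum $\frac1{k+k'}$. Whenever the integrals for the entries of $\mathbf C_n$ converge absolutely, $\det(1+\boldsymbol\Omega\mathbf C_n)=1+\sum_i(\boldsymbol\Omega\mathbf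 C_n)_{ii}+\cdots$ (the sum over $m$ of the sums of the principal $m\times m$ minors) converges to $\tau_n$. 2. $\tau_n$ is twice continuously differentiable in $x_1\in J$. 3. $\tau_n$ satisfies, at all $x_1\in J$ and $n_1,n\in\mathbb Z$, $$\partial_1\ln\Big(2p_1+\partial_1\ln\frac{\tau_n}{\widetilde\tau_n}\Big)=\partial_1\ln\frac{\tau_{n+1}\tau_{n-1}}{\tau_n^2}+\Big(2p_1+\partial_1\ln\frac{\tau_n}{\widetilde\tau_n}\Big)-\frac{2p_1+\partial_1\ln\frac{\tau_{n+1}}{\widetilde\tau_{n+1}}}{1+\frac{\widetilde\tau_n\tau_{n+1}}{\tau_n\widetilde\tau_{n+1}}}-\frac{2p_1+\partial_1\ln\frac{\tau_{n-1}}{\widetilde\tau_{n-1}}}{1+\frac{\widetilde\tau_n\tau_{n-1}}{\tau_n\widetilde\tau_{n-1}}},$$ wherever the equation is defined, i.e. $\tau_n,\tau_{n\pm1},\widetilde\tau_n,\widetilde\tau_{n\pm1}$, the quantity $2p_1+\partial_1\ln(\tau_n/\widetilde\tau_n)$ and the last two denominators do not vanish. Here $\partial_1\ln g=(\partial_1 g)/g$.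 4. The equation is homogeneous of degree 6: there is a polynomial $P$, homogeneous of degree 6, in the values and $x_1$-derivatives of a function $f$ of $(n,n_1,x_1)$ at lattice points, such that for every $f$ that is $C^2$ in $x_1$ the equation for $f$ in place of $\tau$ is equivalent to $P=0$ wherever it is defined. It is not bilinear: no homogeneous polynomial of degree 2 in such quantities is equivalent to it in this sense, not even for all functions $f$ that are smooth in $x_1$. -/

import Mathlib

open MeasureTheory

namespace DL

/-- The integration domain `D ⊆ ℂ × ℂ` and the complex integration measure
`dζ(k,k') = density (k,k') · d base (k,k')` of the direct linearisation. -/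
structure SpectralMeasure where
  base : Measure (ℂ × ℂ)
  density : ℂ × ℂ → ℂ
  domain : Set (ℂ × ℂ)

/-- The plane wave factor `ρ_n(k)`.  Here `x j` is the variable `x_{2j+1}`, while `p i` and `N i`
are `p_{i+1}` and `n_{i+1}`; in particular `x 0`, `p 0`, `N 0` are `x_1`, `p_1`, `n_1`. -/
noncomputable def rho (p : ℕ → ℂ) (x : ℕ → ℝ) (N : ℕ → ℤ) (n : ℤ) (k : ℂ) : ℂ :=
  Complex.exp (∑' j : ℕ, k ^ (2 * j + 1) * (x j : ℂ)) *
    (∏' i : ℕ, ((p i + k) / (p i - k)) ^ (N i)) * k ^ n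

/-- The plane wave factor `σ_n(k')`. -/
noncomputable def sigma (p : ℕ → ℂ) (x : ℕ → ℝ) (N : ℕ → ℤ) (n : ℤ) (k' : ℂ) : ℂ :=
  Complex.exp (∑' j : ℕ, k' ^ (2 * j + 1) * (x j : ℂ)) *
    (∏' i : ℕ, ((p i + k') / (p i - k')) ^ (N i)) * (-k') ^ (-n)

/-- The Cauchy kernel `Ω(k,k')`. -/
noncomputable def kernel (k k' : ℂ) : ℂ := 1 / (k + k')

/-- The parameters are such that kernel and plane wave factors make sense on the domain. -/
structure Regular (Z : SpectralMeasure) (p : ℕ → ℂ) (x : ℕ → ℝ) (N : ℕ → ℤ) : Prop where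
  measurable_domain : MeasurableSet Z.domain
  kernel_ne : ∀ z ∈ Z.domain, ∀ z' ∈ Z.domain, z.1 + z'.2 ≠ 0
  ne_zero : ∀ z ∈ Z.domain, z.1 ≠ 0 ∧ z.2 ≠ 0
  add_ne : ∀ z ∈ Z.domain, ∀ i, p i + z.1 ≠ 0 ∧ p i + z.2 ≠ 0
  sub_ne : ∀ z ∈ Z.domain, ∀ i, p i - z.1 ≠ 0 ∧ p i - z.2 ≠ 0
  summable : ∀ z ∈ Z.domain, Summable (fun j : ℕ => z.1 ^ (2 * j + 1) * (x j : ℂ)) ∧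
    Summable (fun j : ℕ => z.2 ^ (2 * j + 1) * (x j : ℂ))
  multipliable : ∀ z ∈ Z.domain,
    Multipliable (fun i : ℕ => ((p i + z.1) / (p i - z.1)) ^ (N i)) ∧
    Multipliable (fun i : ℕ => ((p i + z.2) / (p i - z.2)) ^ (N i))

/-! ### The infinite matrices -/

/-- The infinite matrix `C_n = ∬_D dζ(k,k') ρ_n(k) c(k) ᵗc(k') σ_n(k')`, where `c(k)` has the
components `k ^ i`, `i ∈ ℤ`. -/
noncomputable def CMat (Z : SpectralMeasure) (p : ℕ → ℂ) (x : ℕ → ℝ) (N : ℕ → ℤ) (n : ℤ) :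
    Matrix ℤ ℤ ℂ := fun i j =>
  ∫ z in Z.domain, rho p x N n z.1 * z.1 ^ i * z.2 ^ j * sigma p x N n z.2 * Z.density z ∂Z.base

/-- The integrals that define the entries of `C_n` converge absolutely. -/
def CMatConverges (Z : SpectralMeasure) (p : ℕ → ℂ) (x : ℕ → ℝ) (N : ℕ → ℤ) (n : ℤ) : Prop :=
  ∀ i j : ℤ, IntegrableOn (fun z : ℂ × ℂ =>
    rho p x N n z.1 * z.1 ^ i * z.2 ^ j * sigma p x N n z.2 * Z.density z) Z.domain Z.base

/-- `Om` is an infinite matrix `Ω` with `ᵗc(k') Ω c(k) = Ω(k,k')` for all spectral parameters `k`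
and `k'` that occur in the domain, the double series on the left being absolutely convergent
with a uniform bound. -/
def IsCauchyMatrix (Z : SpectralMeasure) (Om : Matrix ℤ ℤ ℂ) : Prop :=
  ∃ M : ℝ, ∀ z ∈ Z.domain, ∀ z' ∈ Z.domain,
    Summable (fun q : ℤ × ℤ => ‖z'.2 ^ q.1 * Om q.1 q.2 * z.1 ^ q.2‖) ∧
    ∑' q : ℤ × ℤ, ‖z'.2 ^ q.1 * Om q.1 q.2 * z.1 ^ q.2‖ ≤ M ∧
    ∑' q : ℤ × ℤ, z'.2 ^ q.1 * Om q.1 q.2 * z.1 ^ q.2 = kernel z.1 z'.2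

/-- The product of two infinite matrices. -/
noncomputable def infMul (A B : Matrix ℤ ℤ ℂ) : Matrix ℤ ℤ ℂ := fun i j => ∑' l : ℤ, A i l * B l j

/-- `det (1 + A) = d` for an infinite matrix `A`: the expansion
`1 + ∑_i A_{ii} + ∑_{i<j} |A_{ii} A_{ij}; A_{ji} A_{jj}| + ⋯` converges to `d`. -/
def HasDetOneAdd (A : Matrix ℤ ℤ ℂ) (d : ℂ) : Prop :=
  ∃ e : ℕ → ℂ,
    (∀ m : ℕ, HasSum (fun S : {S : Finset ℤ // S.card = m} =>
      (Matrix.of fun i j : {i : ℤ // i ∈ S.val} => A i.val j.val).det) (e m)) ∧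
    HasSum e d

/-! ### The tau function -/

/-- The integrand, a function of `(k_1,k_1'), …, (k_m,k_m')`, of the term of order `m` in the
expansion of `det (1 + Ω C_n)`.  As `Ω C_n = ∬ dζ(k,k') ρ_n(k) σ_n(k') Ω c(k) ᵗc(k')`, the sum of
the principal minors of order `m` only involves the pairings `ᵗc(k_b') Ω c(k_a) = Ω(k_a,k_b')`. -/
noncomputable def tauIntegrand (Z : SpectralMeasure) (p : ℕ → ℂ) (x : ℕ → ℝ) (N : ℕ → ℤ) (n : ℤ)
    (m : ℕ) (z : Fin m → ℂ × ℂ) : ℂ :=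
  (∏ a, rho p x N n (z a).1 * sigma p x N n (z a).2 * Z.density (z a)) *
    (Matrix.of fun a b : Fin m => kernel (z a).1 (z b).2).det

/-- The measure on `D ^ m` induced by the base measure. -/
noncomputable def baseProd (Z : SpectralMeasure) (m : ℕ) : Measure (Fin m → ℂ × ℂ) :=
  Measure.pi fun _ => Z.base.restrict Z.domain

/-- The tau function `τ_n = det (1 + Ω C_n)`, as the sum of its expansion. -/
noncomputable def tau (Z : SpectralMeasure) (p : ℕ → ℂ) (x : ℕ → ℝ) (N : ℕ → ℤ) (n : ℤ) : ℂ :=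
  ∑' m : ℕ, (1 / (m.factorial : ℂ)) * ∫ z, tauIntegrand Z p x N n m z ∂(baseProd Z m)

/-- The expansion of the tau function, and the ones obtained from it by differentiating
term by term once and twice in `x_1`, converge absolutely. -/
def TauConverges (Z : SpectralMeasure) (p : ℕ → ℂ) (x : ℕ → ℝ) (N : ℕ → ℤ) (n : ℤ) : Prop :=
  ∀ j ≤ 2,
    (∀ m : ℕ, Integrable (fun z : Fin m → ℂ × ℂ =>
      (∑ a, ((z a).1 + (z a).2)) ^ j * tauIntegrand Z p x N n m z) (baseProd Z m)) ∧
    Summable (fun m : ℕ => (1 / (m.factorial : ℝ)) *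
      ∫ z, ‖(∑ a, ((z a).1 + (z a).2)) ^ j * tauIntegrand Z p x N n m z‖ ∂(baseProd Z m))

/-- The tau function as a function of `n`, `n_1` and `x_1`, the other variables being fixed. -/
noncomputable def tauFun (Z : SpectralMeasure) (p : ℕ → ℂ) (x : ℕ → ℝ) (N : ℕ → ℤ)
    (n n₁ : ℤ) (t : ℝ) : ℂ :=
  tau Z p (Function.update x 0 t) (Function.update N 0 n₁) n

/-! ### The differential-difference equation

In this section `f n n₁ t` is an arbitrary function of `n`, `n_1` and `x_1 = t`.  As usual,
`∂ ln g` is the logarithmic derivative of the complex-valued function `g`. -/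

/-- `2 p_1 + ∂_1 ln (f_n / f̃_n)`. -/
noncomputable def shiftTerm (p₁ : ℂ) (f : ℤ → ℤ → ℝ → ℂ) (n n₁ : ℤ) (t : ℝ) : ℂ :=
  2 * p₁ + logDeriv (fun s => f n n₁ s / f n (n₁ + 1) s) t

/-- `1 + f̃_n f_m / (f_n f̃_m)`. -/
noncomputable def crossTerm (f : ℤ → ℤ → ℝ → ℂ) (n m n₁ : ℤ) (t : ℝ) : ℂ :=
  1 + (f n (n₁ + 1) t * f m n₁ t) / (f n n₁ t * f m (n₁ + 1) t)

/-- No denominator and no argument of a logarithm in the equation vanishes. -/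
structure EquationDefined (p₁ : ℂ) (f : ℤ → ℤ → ℝ → ℂ) (n n₁ : ℤ) (t : ℝ) : Prop where
  ne : f n n₁ t ≠ 0
  next_ne : f (n + 1) n₁ t ≠ 0
  prev_ne : f (n - 1) n₁ t ≠ 0
  tilde_ne : f n (n₁ + 1) t ≠ 0
  next_tilde_ne : f (n + 1) (n₁ + 1) t ≠ 0
  prev_tilde_ne : f (n - 1) (n₁ + 1) t ≠ 0
  shift_ne : shiftTerm p₁ f n n₁ t ≠ 0
  cross_next_ne : crossTerm f n (n + 1) n₁ t ≠ 0
  cross_prev_ne : crossTerm f n (n - 1) n₁ t ≠ 0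

/-- The differential-difference equation. -/
def TauEquation (p₁ : ℂ) (f : ℤ → ℤ → ℝ → ℂ) (n n₁ : ℤ) (t : ℝ) : Prop :=
  logDeriv (fun s => shiftTerm p₁ f n n₁ s) t =
    logDeriv (fun s => f (n + 1) n₁ s * f (n - 1) n₁ s / f n n₁ s ^ 2) t
      + shiftTerm p₁ f n n₁ t
      - shiftTerm p₁ f (n + 1) n₁ t / crossTerm f n (n + 1) n₁ t
      - shiftTerm p₁ f (n - 1) n₁ t / crossTerm f n (n - 1) n₁ t

/-- The equation can be written as `P = 0`, where the variable `(i, e, j)` of the polynomial `P`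
stands for the `j`-th derivative with respect to `x_1` of `f` at the lattice point
`(n + i, n_1 + e)`: the two are equivalent for all functions of class `C^r` for which the
equation is defined. -/
def IsPolynomialForm (r : WithTop ℕ∞) (p₁ : ℂ) (P : MvPolynomial (ℤ × ℤ × ℕ) ℂ) : Prop :=
  ∀ (f : ℤ → ℤ → ℝ → ℂ) (n n₁ : ℤ) (t : ℝ),
    (∀ m e : ℤ, ContDiffAt ℝ r (f m e) t) → EquationDefined p₁ f n n₁ t →
    (TauEquation p₁ f n n₁ t ↔
      MvPolynomial.eval (fun v : ℤ × ℤ × ℕ => iteratedDeriv v.2.2 (f (n + v.1) (n₁ + v.2.1)) t) P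
        = 0)

end DL

/-!
The tau function is a sum over finite configurations of points `(k, k')` of the domain: a
configuration contributes the principal minor of `diag(w) K` on its points, where
`K = (1 / (k_a + k_b'))` is the Cauchy matrix and `w` the weight (plane waves times density).

For finitely many points, `τ = det (1 + diag(w) K)`, and everything is linear algebra. Shifting by
a parameter `a` multiplies the weight of `(k, k')` by `(a + k) / (a - k')`. As
`diag(k) K + K diag(k') = (1)`, such a shift and the flow of `x₁` perturb `1 + diag(w) K` by
matrices of rank one, and the formula for determinants of low rank perturbations gives a bilinear
equation for two shifts (`finTau_bilinear`). The shift of `n` is the one with parameter `0`, and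
that of `n₁` is the shift by `p₁` composed with the inverse of the shift by `-p₁`. Hence `τ` and
`τ̃` are the shifts by `-p₁` and `p₁` of one function `g`, and with the shift `h` of `g` by both
the bilinear equations factorise the expressions of the equation:
`τ τ̃ (2 p₁ + ∂ ln (τ / τ̃)) = 2 p₁ g h`, and similarly for the two denominators. Eliminating `g` and
`h` gives a form of degree six that vanishes (`sextic_eq_zero_of_bilinear`).

In the continuous case the integrals for `g` and `h` need not converge, so the elimination is done
before integrating. Give the points of a configuration independent indeterminates as weights; the
determinant becomes a polynomial, and its squarefree coefficients are the minors
(`coeff_sqExp_polyTau`). The sextic form of these polynomials vanishes (`sextic_polyTau`). On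
squarefree coefficients a product is a sum over the ways to split the configuration in two, and by
Fubini the integral over all configurations, weighted by `1 / m!`, turns this convolution into the
product of numbers (`HasConfigInt.mconv`). So the sextic form of `τ` and its termwise derivatives
is the integral of a squarefree coefficient of zero (`sextic_tauJet`). The termwise derivatives are
derivatives because an exponential in `x₁` is dominated by the sum of its values at the endpoints
of an interval (`hasDerivAt_laplaceSeries`).

For `det (1 + Ω C_n)`, sums over index sets are replaced by sums over tuples
(`hasSum_principalMinors`), the determinants are expanded into permutations, and the sums over
indices are exchanged with the integrals; for each permutation, they produce the corresponding
product of Cauchy kernels (`hasSum_integral_perm`).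

The equation is not bilinear because there is a line in the space of jets along which the sextic
form has three distinct zeros at which the equation is defined, while a form of degree two
restricts to a polynomial of degree at most two, and would thus vanish on the whole line
(`not_isPolynomialForm_of_isHomogeneous_two`).
-/

namespace DL

open scoped Matrix

/-! ### The bilinear equations of the Cauchy determinant -/

section Determinant

variable {ι R : Type*} [Fintype ι] [DecidableEq ι] [CommRing R]

theorem derivation_prod {B : Type*} [CommRing B] [Algebra B R] (D : Derivation B R R)
    {κ : Type*} [DecidableEq κ] (s : Finset κ) (f : κ → R) :
    D (∏ i ∈ s, f i) = ∑ i ∈ s, D (f i) * ∏ j ∈ s.erase i, f j := by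
  induction s using Finset.induction_on with
  | empty => simp
  | insert a s ha ih =>
    rw [Finset.prod_insert ha, D.leibniz, ih, Finset.sum_insert ha, Finset.erase_insert ha,
      smul_eq_mul, smul_eq_mul, add_comm, mul_comm, Finset.mul_sum]
    congr 1
    refine Finset.sum_congr rfl fun i hi => ?_
    have hia : a ≠ i := fun h => ha (h ▸ hi)
    rw [Finset.erase_insert_of_ne hia, Finset.prod_insert (fun h => ha (Finset.mem_of_mem_erase h))]
    ring

/-- Jacobi's formula for a derivation. -/
theorem derivation_det {B : Type*} [CommRing B] [Algebra B R] (D : Derivation B R R)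
    (A : Matrix ι ι R) : D A.det = (A.adjugate * A.map D).trace := by
  have h1 : D A.det = ∑ i, (A.updateCol i fun r => D (A r i)).det := by
    simp_rw [Matrix.det_apply, map_sum]
    rw [Finset.sum_comm]
    refine Finset.sum_congr rfl fun σ _ => ?_
    rw [Units.smul_def, map_zsmul, derivation_prod, Finset.smul_sum]
    refine Finset.sum_congr rfl fun i _ => ?_
    rw [Units.smul_def, ← Finset.mul_prod_erase _ _ (Finset.mem_univ i), Matrix.updateCol_self]
    congr 2
    refine Finset.prod_congr rfl fun j hj => ?_
    rw [Matrix.updateCol_ne (Finset.ne_of_mem_erase hj)]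
  rw [h1, Matrix.trace]
  refine Finset.sum_congr rfl fun i _ => ?_
  rw [← Matrix.cramer_apply, Matrix.cramer_eq_adjugate_mulVec]
  rfl

/-- The finite tau function `det (1 + diag(w) K)` of the weights `w`. -/
noncomputable def finTau (K : Matrix ι ι R) (w : ι → R) : R :=
  (1 + Matrix.diagonal w * K).det

/-- The derivative of `finTau` along the flow that multiplies the `i`-th weight by
`exp ((k i + k' i) x)`, when `K` is the Cauchy matrix `1 / (k i + k' j)`;
see `derivation_finTau`. -/
noncomputable def finTauDeriv (K : Matrix ι ι R) (w : ι → R) : R :=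
  ((1 + Matrix.diagonal w * K).adjugate * Matrix.vecMulVec w 1).trace

/-- By Jacobi's formula; as `diag(k) K + K diag(k')` is the matrix of ones, the derivative of
`diag(w) K` is `w ᵗ(1)` up to a commutator with `diag(k')`, which has no trace against the
adjugate. -/
theorem derivation_finTau {B : Type*} [CommRing B] [Algebra B R] (D : Derivation B R R)
    (K : Matrix ι ι R) (w k k' : ι → R) (hK : ∀ i j, (k i + k' j) * K i j = 1)
    (hDK : ∀ i j, D (K i j) = 0) (hDw : ∀ i, D (w i) = (k i + k' i) * w i) :
    D (finTau K w) = finTauDeriv K w := by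
  have hmap : (1 + Matrix.diagonal w * K).map D =
      Matrix.vecMulVec w 1 + (Matrix.diagonal k' * (Matrix.diagonal w * K)
        - (Matrix.diagonal w * K) * Matrix.diagonal k') := by
    ext i j
    have h1 : D ((1 : Matrix ι ι R) i j) = 0 := by
      rw [Matrix.one_apply]; split_ifs <;> simp
    simp only [Matrix.map_apply, Matrix.add_apply, map_add, h1, Matrix.diagonal_mul,
      Derivation.leibniz, hDK, hDw, Matrix.sub_apply, Matrix.mul_diagonal, smul_eq_mul,
      Matrix.vecMulVec_apply, Pi.one_apply]
    linear_combination w i * hK i j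
  rw [finTau, derivation_det, hmap, finTauDeriv, Matrix.mul_add, Matrix.trace_add]
  set A := 1 + Matrix.diagonal w * K with hA
  have hW : Matrix.diagonal w * K = A - 1 := by rw [hA]; abel
  have h1 : (A.adjugate * (Matrix.diagonal k' * (A - 1))).trace
      = (A.det • Matrix.diagonal k').trace - (A.adjugate * Matrix.diagonal k').trace := by
    rw [Matrix.mul_sub, Matrix.mul_one, Matrix.mul_sub, Matrix.trace_sub, ← Matrix.mul_assoc,
      Matrix.trace_mul_comm, ← Matrix.mul_assoc, Matrix.mul_adjugate, Matrix.smul_mul,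
      Matrix.one_mul]
  have h2 : (A.adjugate * ((A - 1) * Matrix.diagonal k')).trace
      = (A.det • Matrix.diagonal k').trace - (A.adjugate * Matrix.diagonal k').trace := by
    rw [← Matrix.mul_assoc, Matrix.mul_sub, Matrix.mul_one, Matrix.adjugate_mul, Matrix.sub_mul,
      Matrix.trace_sub, Matrix.smul_mul, Matrix.one_mul]
  rw [hW, Matrix.mul_sub, Matrix.trace_sub, h1, h2, sub_self, add_zero]

theorem finTau_map {S : Type*} [CommRing S] (φ : R →+* S) (K : Matrix ι ι R) (w : ι → R) :
    φ (finTau K w) = finTau (K.map φ) (fun i => φ (w i)) := by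
  rw [finTau, finTau, RingHom.map_det]
  congr 1
  ext i j
  simp [Matrix.one_apply, apply_ite φ]

theorem finTauDeriv_map {S : Type*} [CommRing S] (φ : R →+* S) (K : Matrix ι ι R) (w : ι → R) :
    φ (finTauDeriv K w) = finTauDeriv (K.map φ) (fun i => φ (w i)) := by
  have h : φ.mapMatrix (1 + Matrix.diagonal w * K)
      = 1 + Matrix.diagonal (fun i => φ (w i)) * K.map φ := by
    ext i j
    simp [Matrix.one_apply, apply_ite φ]
  rw [finTauDeriv, finTauDeriv, ← h, ← RingHom.map_adjugate]
  simp [Matrix.trace, Matrix.mul_apply]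

end Determinant

theorem mul_mul_apply_eq_dotProduct_mulVec {ι m n F : Type*} [Fintype ι] [CommRing F]
    (V : Matrix m ι F) (A : Matrix ι ι F) (U : Matrix ι n F) (i : m) (j : n) :
    (V * (A * U)) i j = V i ⬝ᵥ (A *ᵥ fun r => U r j) := rfl

section Field

variable {ι F : Type*} [Fintype ι] [DecidableEq ι] [Field F]

/-- A perturbation of rank one. -/
theorem det_add_vecMulVec (A : Matrix ι ι F) (hA : A.det ≠ 0) (u v : ι → F) :
    (A + Matrix.vecMulVec u v).det = A.det * (1 + v ⬝ᵥ (A⁻¹ *ᵥ u)) := by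
  rw [Matrix.vecMulVec_eq Unit, Matrix.det_add_mul _ _ (isUnit_iff_ne_zero.2 hA),
    Matrix.mul_assoc, Matrix.det_unique (n := Unit)]
  rfl

/-- A perturbation of rank two. -/
theorem det_add_two_vecMulVec (A : Matrix ι ι F) (hA : A.det ≠ 0) (u₁ v₁ u₂ v₂ : ι → F) :
    (A + Matrix.vecMulVec u₁ v₁ + Matrix.vecMulVec u₂ v₂).det = A.det *
      ((1 + v₁ ⬝ᵥ (A⁻¹ *ᵥ u₁)) * (1 + v₂ ⬝ᵥ (A⁻¹ *ᵥ u₂))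
        - (v₁ ⬝ᵥ (A⁻¹ *ᵥ u₂)) * (v₂ ⬝ᵥ (A⁻¹ *ᵥ u₁))) := by
  have h : A + Matrix.vecMulVec u₁ v₁ + Matrix.vecMulVec u₂ v₂ =
      A + (Matrix.of fun i (j : Fin 2) => ![u₁ i, u₂ i] j) * (Matrix.of ![v₁, v₂]) := by
    ext i j
    simp [Matrix.mul_apply, Fin.sum_univ_two, Matrix.vecMulVec_apply, add_assoc]
  rw [h, Matrix.det_add_mul _ _ (isUnit_iff_ne_zero.2 hA), Matrix.det_fin_two,
    Matrix.mul_assoc]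
  simp only [Matrix.add_apply, mul_mul_apply_eq_dotProduct_mulVec]
  simp
  exact Or.inl rfl

/-- The flow as a perturbation of rank one. -/
theorem finTau_add_finTauDeriv (K : Matrix ι ι F) (w : ι → F) (h : finTau K w ≠ 0) :
    finTau K w + finTauDeriv K w
      = (1 + Matrix.diagonal w * K + Matrix.vecMulVec w 1).det := by
  rw [det_add_vecMulVec _ h, finTauDeriv, mul_add, mul_one, finTau]
  congr 1
  rw [Matrix.inv_def, Matrix.trace_mul_comm, Matrix.smul_mulVec, dotProduct_smul, smul_eq_mul,
    Ring.inverse_eq_inv', mul_inv_cancel_left₀ (show (1 + Matrix.diagonal w * K).det ≠ 0 from h)]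
  simp [Matrix.trace, Matrix.mul_apply, dotProduct, Matrix.mulVec,
    mul_comm]
  rw [Finset.sum_comm]

theorem det_one_add_diagonal_comm (α c : ι → F) (M : Matrix ι ι F) :
    (1 + Matrix.diagonal (fun i => c i * α i) * M).det
      = (1 + Matrix.diagonal c * M * Matrix.diagonal α).det := by
  have : Matrix.diagonal (fun i => c i * α i) * M
      = Matrix.diagonal α * (Matrix.diagonal c * M) := by
    rw [← Matrix.mul_assoc, Matrix.diagonal_mul_diagonal]; simp_rw [mul_comm]
  rw [this, Matrix.det_one_add_mul_comm]

/-- The bilinear equation between the shifts by `a` and `b`, over a field.  With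
`G = (1 + diag(w) K)⁻¹ diag(w)`, `e` the vector of ones, `α = 1 / (a - k')` and
`β = 1 / (b - k')`, the shift by `a` and the flow become perturbations of `1 + diag(w) K` of rank
one, and two shifts one of rank two, so that all quantities are expressed by `finTau K w`,
`ᵗα G e`, `ᵗα G k`, `ᵗβ G e`, `ᵗβ G k`. -/
theorem finTau_bilinear_field (K : Matrix ι ι F) (w k k' : ι → F)
    (hK : ∀ i j, (k i + k' j) * K i j = 1) (a b : F) (α β : ι → F)
    (hα : ∀ i, (a - k' i) * α i = 1) (hβ : ∀ i, (b - k' i) * β i = 1)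
    (h : finTau K w ≠ 0) (ha : finTau K (fun i => w i * (a + k i) * α i) ≠ 0)
    (hb : finTau K (fun i => w i * (b + k i) * β i) ≠ 0) :
    finTauDeriv K (fun i => w i * (a + k i) * α i) * finTau K (fun i => w i * (b + k i) * β i)
      - finTau K (fun i => w i * (a + k i) * α i)
        * finTauDeriv K (fun i => w i * (b + k i) * β i)
    = (a - b) * (finTau K (fun i => w i * (a + k i) * α i)
          * finTau K (fun i => w i * (b + k i) * β i)
        - finTau K w * finTau K (fun i => w i * (a + k i) * α i * (b + k i) * β i)) := by
  set A := 1 + Matrix.diagonal w * K with hA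
  have hf : A.det ≠ 0 := h
  let u : (ι → F) → (ι → F) → F := fun x y => x ⬝ᵥ (A⁻¹ *ᵥ y)
  have u_add : ∀ x y z, u x (y + z) = u x y + u x z := fun x y z => by
    simp only [u, Matrix.mulVec_add, dotProduct_add]
  have u_smul : ∀ (c : F) x y, u x (c • y) = c * u x y := fun c x y => by
    simp only [u, Matrix.mulVec_smul, dotProduct_smul, smul_eq_mul]
  have u_sub' : ∀ x y z, u (x - y) z = u x z - u y z := fun x y z => by
    simp only [u, sub_dotProduct]
  have u_smul' : ∀ (c : F) x y, u (c • x) y = c * u x y := fun c x y => by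
    simp only [u, smul_dotProduct, smul_eq_mul]
  have shift : ∀ (c : F) (γ : ι → F), (∀ i, (c - k' i) * γ i = 1) →
      finTau K (fun i => w i * (c + k i) * γ i) = A.det * (1 + u γ w) := by
    intro c γ hγ
    rw [finTau, det_one_add_diagonal_comm, ← det_add_vecMulVec A hf]
    congr 1
    ext i j
    simp only [hA, Matrix.add_apply, Matrix.diagonal_mul, Matrix.mul_diagonal,
      Matrix.vecMulVec_apply]
    linear_combination w i * γ j * hK i j + w i * K i j * hγ j
  have shiftDeriv : ∀ (c : F) (γ : ι → F), (∀ i, (c - k' i) * γ i = 1) →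
      finTau K (fun i => w i * (c + k i) * γ i) ≠ 0 →
      finTauDeriv K (fun i => w i * (c + k i) * γ i)
        = A.det * (c * u γ w + u γ (w * k)) := by
    intro c γ hγ h0
    have h1 := finTau_add_finTauDeriv K _ h0
    have h2 : (1 + Matrix.diagonal (fun i => w i * (c + k i) * γ i) * K
        + Matrix.vecMulVec (fun i => w i * (c + k i) * γ i) 1).det
        = A.det * (1 + u γ (w + (c • w + w * k))) := by
      rw [← det_add_vecMulVec A hf]
      have : 1 + Matrix.diagonal (fun i => w i * (c + k i) * γ i) * K
        + Matrix.vecMulVec (fun i => w i * (c + k i) * γ i) 1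
        = 1 + Matrix.diagonal (fun i => w i * (c + k i) * γ i) * (K + Matrix.of fun _ _ => 1) := by
        ext i j
        simp [mul_add, add_assoc]
      rw [this, det_one_add_diagonal_comm]
      congr 1
      ext i j
      simp only [hA, Matrix.add_apply, Matrix.diagonal_mul, Matrix.mul_diagonal,
        Matrix.vecMulVec_apply, Pi.add_apply, Pi.smul_apply, Pi.mul_apply, smul_eq_mul,
        Matrix.of_apply]
      linear_combination w i * γ j * hK i j + w i * K i j * hγ j
    rw [h2, shift c γ hγ, u_add, u_add, u_smul] at h1
    linear_combination h1
  have shift2 : finTau K (fun i => w i * (a + k i) * α i * (b + k i) * β i)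
      = A.det * ((1 + u β w) * (1 + u (α * β) (b • w + w * k))
        - u β (b • w + w * k) * u (α * β) w) := by
    rw [← det_add_two_vecMulVec A hf, finTau]
    have : (fun i => w i * (a + k i) * α i * (b + k i) * β i)
        = fun i => (w i * (a + k i) * (b + k i)) * (α * β) i := by
      ext i; simp only [Pi.mul_apply]; ring
    rw [this, det_one_add_diagonal_comm]
    congr 1
    ext i j
    simp only [hA, Matrix.add_apply, Matrix.diagonal_mul, Matrix.mul_diagonal,
      Matrix.vecMulVec_apply, Pi.add_apply, Pi.smul_apply, Pi.mul_apply, smul_eq_mul]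
    linear_combination
      (w i * (b + k i) * α j * β j + w i * β j) * hK i j
        + (w i * (b + k i) * β j * K i j) * hα j + w i * K i j * hβ j
  -- partial fractions, which reduce `ᵗ(αβ) G` to `ᵗα G` and `ᵗβ G`
  have pf : (a - b) • (α * β) = β - α := by
    ext i
    simp only [Pi.smul_apply, Pi.mul_apply, Pi.sub_apply, smul_eq_mul]
    linear_combination β i * hα i - α i * hβ i
  have pf' : ∀ y, (a - b) * u (α * β) y = u β y - u α y := fun y => by
    rw [← u_smul', pf, u_sub']
  rw [shiftDeriv a α hα ha, shiftDeriv b β hβ hb, shift2, shift a α hα, shift b β hβ]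
  have hfw : finTau K w = A.det := rfl
  rw [hfw, u_add, u_add, u_smul, u_smul]
  linear_combination (A.det * A.det) * ((1 + u β w) * (b * pf' w + pf' (w * k))
    - (b * u β w + u β (w * k)) * pf' w)

end Field

/-- The bilinear equation between the shifts by `a` and `b`, in an integral domain, where the
inverses `α`, `β` have to be given. -/
theorem finTau_bilinear {ι R : Type*} [Fintype ι] [DecidableEq ι] [CommRing R] [IsDomain R]
    (K : Matrix ι ι R) (w k k' : ι → R)
    (hK : ∀ i j, (k i + k' j) * K i j = 1) (a b : R) (α β : ι → R)
    (hα : ∀ i, (a - k' i) * α i = 1) (hβ : ∀ i, (b - k' i) * β i = 1)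
    (h : finTau K w ≠ 0) (ha : finTau K (fun i => w i * (a + k i) * α i) ≠ 0)
    (hb : finTau K (fun i => w i * (b + k i) * β i) ≠ 0) :
    finTauDeriv K (fun i => w i * (a + k i) * α i) * finTau K (fun i => w i * (b + k i) * β i)
      - finTau K (fun i => w i * (a + k i) * α i)
        * finTauDeriv K (fun i => w i * (b + k i) * β i)
    = (a - b) * (finTau K (fun i => w i * (a + k i) * α i)
          * finTau K (fun i => w i * (b + k i) * β i)
        - finTau K w * finTau K (fun i => w i * (a + k i) * α i * (b + k i) * β i)) := by
  have hinj := IsFractionRing.injective R (FractionRing R)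
  set φ := algebraMap R (FractionRing R)
  apply hinj
  have hne : ∀ v : ι → R, finTau K v ≠ 0 → finTau (K.map φ) (fun i => φ (v i)) ≠ 0 := by
    intro v hv
    rw [← finTau_map]
    exact fun h0 => hv (hinj (by rw [h0, map_zero]))
  have := finTau_bilinear_field (K.map φ) (fun i => φ (w i)) (fun i => φ (k i))
    (fun i => φ (k' i)) (fun i j => by simpa using congrArg φ (hK i j)) (φ a) (φ b)
    (fun i => φ (α i)) (fun i => φ (β i)) (fun i => by simpa using congrArg φ (hα i))
    (fun i => by simpa using congrArg φ (hβ i)) (hne _ h) (by simpa using hne _ ha)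
    (by simpa using hne _ hb)
  simpa [finTau_map, finTauDeriv_map] using this

/-! ### The sextic form -/

/-- The homogeneous form of degree six of the equation.  Here `v i e j` stands for the `j`-th
derivative of the function at the lattice point `(n + i, n₁ + e)`.  The form is
`Y' X X' - Y (Z X' + Z' X + 2 p X X')`, where `Y = τ τ̃ (2 p + ∂ ln (τ / τ̃))`, `Y' = ∂Y`,
`X`, `X'` are the numerators of the two denominators of the equation, and `Z`, `Z'` those of its
last two terms up to logarithmic derivatives. -/
noncomputable def sextic {R : Type*} [CommRing R] (p : R) (v : ℤ → ℤ → ℕ → R) : R :=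
  (v 0 0 2 * v 0 1 0 - v 0 0 0 * v 0 1 2 + 2 * p * (v 0 0 1 * v 0 1 0 + v 0 0 0 * v 0 1 1))
      * (v 1 0 0 * v 0 1 0 + v 1 1 0 * v 0 0 0) * (v (-1) 0 0 * v 0 1 0 + v (-1) 1 0 * v 0 0 0)
    - (v 0 0 1 * v 0 1 0 - v 0 0 0 * v 0 1 1 + 2 * p * (v 0 0 0 * v 0 1 0))
      * ((v 1 0 1 * v 0 1 0 + v 0 0 0 * v 1 1 1 - 2 * p * (v 0 0 0 * v 1 1 0))
          * (v (-1) 0 0 * v 0 1 0 + v (-1) 1 0 * v 0 0 0)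
        + (v (-1) 0 1 * v 0 1 0 + v 0 0 0 * v (-1) 1 1 - 2 * p * (v 0 0 0 * v (-1) 1 0))
          * (v 1 0 0 * v 0 1 0 + v 1 1 0 * v 0 0 0)
        + 2 * p * ((v 1 0 0 * v 0 1 0 + v 1 1 0 * v 0 0 0)
          * (v (-1) 0 0 * v 0 1 0 + v (-1) 1 0 * v 0 0 0)))

/-- Elimination of the auxiliary functions `g`, `h` from the bilinear equations.  The functions
`v 0 0 0` and `v 0 1 0` are the shifts of `g` by `-p` and by `p`, and `h` is the shift of `g` by
both; `gp`, `hp'` and `gm`, `hm` are the same at `n + 1` and `n - 1`. -/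
theorem sextic_eq_zero_of_bilinear {B R : Type*} [CommRing B] [CommRing R] [IsDomain R]
    [CharZero R] [Algebra B R] (D : Derivation B R R) (p : R) (hp : D p = 0)
    (v : ℤ → ℤ → ℕ → R) (hv1 : ∀ i e, v i e 1 = D (v i e 0)) (hv2 : ∀ i e, v i e 2 = D (v i e 1))
    {g gp gm h hp' hm : R} (hc : v 1 0 0 ≠ 0) (he : v (-1) 0 0 ≠ 0)
    (h0 : D (v 0 0 0) * v 0 1 0 - v 0 0 0 * D (v 0 1 0) = -2 * p * (v 0 0 0 * v 0 1 0 - g * h))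
    (h1 : D (v 1 0 0) * v 1 1 0 - v 1 0 0 * D (v 1 1 0) = -2 * p * (v 1 0 0 * v 1 1 0 - gp * hp'))
    (h2 : D (v (-1) 0 0) * v (-1) 1 0 - v (-1) 0 0 * D (v (-1) 1 0)
      = -2 * p * (v (-1) 0 0 * v (-1) 1 0 - gm * hm))
    (h3 : p * (2 * h * gp) = p * (v 1 0 0 * v 0 1 0 + v 1 1 0 * v 0 0 0))
    (h4 : p * (2 * hm * g) = p * (v (-1) 0 0 * v 0 1 0 + v (-1) 1 0 * v 0 0 0))
    (h5 : D h * v 1 0 0 - h * D (v 1 0 0) = p * (h * v 1 0 0 - v 0 0 0 * hp'))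
    (h6 : D g * v (-1) 0 0 - g * D (v (-1) 0 0) = p * (g * v (-1) 0 0 - gm * v 0 0 0)) :
    sextic p v = 0 := by
  -- below, `a`, `c`, `e` are the functions at `n`, `n + 1`, `n - 1`, and `b`, `d`, `f` those at
  -- `n₁ + 1`
  have hD2 : D 2 = 0 := by simpa using D.map_natCast 2
  have hY := congrArg D h0
  simp only [Derivation.leibniz, map_sub, map_neg, hp, smul_eq_mul, hD2, mul_zero, neg_zero,
    add_zero] at hY
  unfold sextic
  simp only [hv2, hv1]
  generalize D (D (v 0 0 0)) = a2 at *
  generalize D (D (v 0 1 0)) = b2 at *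
  generalize D (v 0 0 0) = a1 at *
  generalize D (v 0 1 0) = b1 at *
  generalize D (v 1 0 0) = c1 at *
  generalize D (v 1 1 0) = d1 at *
  generalize D (v (-1) 0 0) = e1 at *
  generalize D (v (-1) 1 0) = f1 at *
  generalize D g = g1 at *
  generalize D h = h1' at *
  generalize v 0 0 0 = a at *
  generalize v 0 1 0 = b at *
  generalize v 1 0 0 = c at *
  generalize v 1 1 0 = d at *
  generalize v (-1) 0 0 = e at *
  generalize v (-1) 1 0 = f at *
  by_cases hp0 : p = 0
  · subst hp0
    linear_combination (c * b + d * a) * (e * b + f * a) * hY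
      - ((c1 * b + a * d1) * (e * b + f * a) + (e1 * b + a * f1) * (c * b + d * a)) * h0
  have X1 := mul_left_cancel₀ hp0 h3
  have X2 := mul_left_cancel₀ hp0 h4
  have Z1 : 2 * gp * h1' = c1 * b + a * d1 - 2 * p * (a * d) + p * (c * b + d * a) := by
    apply mul_left_cancel₀ hc
    linear_combination 2 * gp * h5 + (c1 + p * c) * X1 + a * h1
  have Z2 : 2 * hm * g1 = e1 * b + a * f1 - 2 * p * (a * f) + p * (e * b + f * a) := by
    apply mul_left_cancel₀ he
    linear_combination 2 * hm * h6 + (e1 + p * e) * X2 + a * h2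
  have Y0 : a1 * b - a * b1 + 2 * p * (a * b) = 2 * p * (g * h) := by linear_combination h0
  have Y1 : a2 * b - a * b2 + 2 * p * (a1 * b + a * b1) = 2 * p * (g1 * h + g * h1') := by
    linear_combination hY
  have e1' : c1 * b + a * d1 - 2 * p * (a * d) = 2 * gp * h1' - p * (2 * h * gp) := by
    linear_combination p * X1 - Z1
  have e2' : e1 * b + a * f1 - 2 * p * (a * f) = 2 * hm * g1 - p * (2 * hm * g) := by
    linear_combination p * X2 - Z2
  rw [Y0, Y1, e1', e2', ← X1, ← X2]
  ring

/-! ### Finite tau functions with indeterminate weights -/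

section Poly

variable {ι : Type*} [Fintype ι] [DecidableEq ι]

open MvPolynomial

/-- The finite tau function in which each weight carries an indeterminate of its own.  It is a
nonzero polynomial, so that it can be cancelled, and its squarefree coefficients are the minors of
`diag(w) K`. -/
noncomputable def polyTau (K : Matrix ι ι ℂ) (w : ι → ℂ) : MvPolynomial ι ℂ :=
  finTau (K.map (C : ℂ →+* MvPolynomial ι ℂ)) (fun i => C (w i) * X i)

/-- The derivation that multiplies the `i`-th indeterminate by `κ i`. -/
noncomputable def weightDerivation (κ : ι → ℂ) :
    Derivation ℂ (MvPolynomial ι ℂ) (MvPolynomial ι ℂ) :=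
  mkDerivation ℂ fun i => C (κ i) * X i

theorem polyTau_ne_zero (K : Matrix ι ι ℂ) (w : ι → ℂ) : polyTau K w ≠ 0 := by
  intro h
  have := congrArg (constantCoeff : MvPolynomial ι ℂ →+* ℂ) h
  rw [polyTau, finTau_map] at this
  simp [finTau] at this

/-- The bilinear equation between the shifts by `a` and by `b`. -/
theorem polyTau_bilinear (K : Matrix ι ι ℂ) (w k k' : ι → ℂ)
    (hK : ∀ i j, (k i + k' j) * K i j = 1) (a b : ℂ)
    (ha : ∀ i, a - k' i ≠ 0) (hb : ∀ i, b - k' i ≠ 0) {wa wb wab : ι → ℂ}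
    (hwa : ∀ i, wa i = w i * ((a + k i) / (a - k' i)))
    (hwb : ∀ i, wb i = w i * ((b + k i) / (b - k' i)))
    (hwab : ∀ i, wab i = w i * ((a + k i) / (a - k' i)) * ((b + k i) / (b - k' i))) :
    weightDerivation (fun i => k i + k' i) (polyTau K wa) * polyTau K wb
      - polyTau K wa * weightDerivation (fun i => k i + k' i) (polyTau K wb)
    = (C a - C b) * (polyTau K wa * polyTau K wb - polyTau K w * polyTau K wab) := by
  have hK' : ∀ i j, (C (k i) + C (k' j)) * (K.map (C : ℂ →+* MvPolynomial ι ℂ)) i j = 1 := by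
    intro i j
    rw [Matrix.map_apply, ← C_add, ← C_mul, hK, C_1]
  have key := fun v : ι → ℂ => derivation_finTau (weightDerivation fun i => k i + k' i)
    (K.map (C : ℂ →+* MvPolynomial ι ℂ)) (fun i => C (v i) * X i) (fun i => C (k i))
    (fun i => C (k' i)) hK' (fun i j => by simp [weightDerivation])
    (fun i => by simp [weightDerivation, mkDerivation_X]; ring)
  have ea : (fun i => C (wa i) * X i : ι → MvPolynomial ι ℂ)
      = fun i => C (w i) * X i * (C a + C (k i)) * C (a - k' i)⁻¹ := by
    funext i; rw [hwa, div_eq_mul_inv]; simp only [C_mul, C_add]; ring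
  have eb : (fun i => C (wb i) * X i : ι → MvPolynomial ι ℂ)
      = fun i => C (w i) * X i * (C b + C (k i)) * C (b - k' i)⁻¹ := by
    funext i; rw [hwb, div_eq_mul_inv]; simp only [C_mul, C_add]; ring
  have eab : (fun i => C (wab i) * X i : ι → MvPolynomial ι ℂ)
      = fun i => C (w i) * X i * (C a + C (k i)) * C (a - k' i)⁻¹ * (C b + C (k i))
        * C (b - k' i)⁻¹ := by
    funext i; rw [hwab, div_eq_mul_inv, div_eq_mul_inv]; simp only [C_mul, C_add]; ring
  have hinv : ∀ c : ℂ, (∀ i, c - k' i ≠ 0) → ∀ i,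
      (C c - C (k' i)) * (C (c - k' i)⁻¹ : MvPolynomial ι ℂ) = 1 := fun c hc i => by
    rw [← C_sub, ← C_mul, mul_inv_cancel₀ (hc i), C_1]
  have ha0 := polyTau_ne_zero K wa
  have hb0 := polyTau_ne_zero K wb
  have ka : weightDerivation (fun i => k i + k' i) (polyTau K wa) = _ := key wa
  have kb : weightDerivation (fun i => k i + k' i) (polyTau K wb) = _ := key wb
  rw [ka, kb]
  unfold polyTau at *
  rw [ea] at ha0 ⊢
  rw [eb] at hb0 ⊢
  rw [eab]
  exact finTau_bilinear (K.map (C : ℂ →+* MvPolynomial ι ℂ)) (fun i => C (w i) * X i)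
    (fun i => C (k i)) (fun i => C (k' i)) hK' (C a) (C b) (fun i => C (a - k' i)⁻¹)
    (fun i => C (b - k' i)⁻¹) (hinv a ha) (hinv b hb) (polyTau_ne_zero K w) ha0 hb0

/-- The three-term equation between the shifts by `a`, `b` and `c`. -/
theorem polyTau_threeTerm (K : Matrix ι ι ℂ) (w k k' : ι → ℂ)
    (hK : ∀ i j, (k i + k' j) * K i j = 1) (a b c : ℂ)
    (ha : ∀ i, a - k' i ≠ 0) (hb : ∀ i, b - k' i ≠ 0) (hc : ∀ i, c - k' i ≠ 0)
    {wa wb wc wab wbc wca : ι → ℂ}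
    (hwa : ∀ i, wa i = w i * ((a + k i) / (a - k' i)))
    (hwb : ∀ i, wb i = w i * ((b + k i) / (b - k' i)))
    (hwc : ∀ i, wc i = w i * ((c + k i) / (c - k' i)))
    (hwab : ∀ i, wab i = w i * ((a + k i) / (a - k' i)) * ((b + k i) / (b - k' i)))
    (hwbc : ∀ i, wbc i = w i * ((b + k i) / (b - k' i)) * ((c + k i) / (c - k' i)))
    (hwca : ∀ i, wca i = w i * ((c + k i) / (c - k' i)) * ((a + k i) / (a - k' i))) :
    (C a - C b) * polyTau K wab * polyTau K wc + (C b - C c) * polyTau K wbc * polyTau K wa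
      + (C c - C a) * polyTau K wca * polyTau K wb = 0 := by
  apply mul_left_cancel₀ (polyTau_ne_zero K w)
  linear_combination
    polyTau K wc * polyTau_bilinear K w k k' hK a b ha hb hwa hwb hwab
    + polyTau K wa * polyTau_bilinear K w k k' hK b c hb hc hwb hwc hwbc
    + polyTau K wb * polyTau_bilinear K w k k' hK c a hc ha hwc hwa hwca

/-- The sextic equation for finite tau functions. -/
theorem sextic_polyTau (K : Matrix ι ι ℂ) (w k k' : ι → ℂ) (p : ℂ)
    (hK : ∀ i j, (k i + k' j) * K i j = 1) (hk : ∀ i, k i ≠ 0) (hk' : ∀ i, k' i ≠ 0)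
    (h1 : ∀ i, p + k i ≠ 0) (h2 : ∀ i, p + k' i ≠ 0) (h3 : ∀ i, p - k i ≠ 0)
    (h4 : ∀ i, p - k' i ≠ 0) (W : ℤ → ℤ → ι → ℂ)
    (hW : ∀ n e i, W n e i = w i * (k i / (-k' i)) ^ n *
      ((p + k i) / (p - k i) * ((p + k' i) / (p - k' i))) ^ e) :
    sextic (C p) (fun n e j => (weightDerivation fun i => k i + k' i)^[j] (polyTau K (W n e)))
      = 0 := by
  have h4' : ∀ i, -p - k' i ≠ 0 := fun i h => h2 i (by linear_combination -h)
  have h0' : ∀ i, (0 : ℂ) - k' i ≠ 0 := fun i h => hk' i (by linear_combination -h)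
  have hn' : ∀ i, -k' i ≠ 0 := fun i => neg_ne_zero.2 (hk' i)
  -- the weights of the function shifted backwards by `-p`
  let G : ℤ → ι → ℂ := fun n i => w i * (k i / (-k' i)) ^ n * ((p + k' i) / (p - k i))
  -- the weights of the function shifted forwards by `p`
  let H : ℤ → ι → ℂ := fun n i => w i * (k i / (-k' i)) ^ n * ((p + k i) / (p - k' i))
  have hr : ∀ (n : ℤ) i, (k i / (-k' i)) ^ (n + 1) = (k i / (-k' i)) ^ n * (k i / (-k' i)) :=
    fun n i => zpow_add_one₀ (div_ne_zero (hk i) (hn' i)) n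
  have rel : ∀ n i,
      W n 0 i = G n i * ((-p + k i) / (-p - k' i)) ∧ W n 1 i = G n i * ((p + k i) / (p - k' i)) ∧
      H n i = G n i * ((-p + k i) / (-p - k' i)) * ((p + k i) / (p - k' i)) ∧
      G (n + 1) i = G n i * ((0 + k i) / (0 - k' i)) ∧
      W (n + 1) 0 i = G n i * ((0 + k i) / (0 - k' i)) * ((-p + k i) / (-p - k' i)) ∧
      W (n + 1) 1 i = G n i * ((0 + k i) / (0 - k' i)) * ((p + k i) / (p - k' i)) ∧
      H n i = W n 0 i * ((p + k i) / (p - k' i)) ∧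
      W (n + 1) 0 i = W n 0 i * ((0 + k i) / (0 - k' i)) ∧
      H (n + 1) i = W n 0 i * ((p + k i) / (p - k' i)) * ((0 + k i) / (0 - k' i)) := by
    intro n i
    have e1 := h1 i; have e2 := h2 i; have e3 := h3 i; have e4 := h4 i; have e5 := h4' i
    have e6 := hk' i
    have q : (-p + k i) / (-p - k' i) = (p - k i) / (p + k' i) := by
      rw [div_eq_div_iff e5 e2]; ring
    have q0 : (0 + k i) / (0 - k' i) = k i / (-k' i) := by rw [zero_add, zero_sub]
    simp only [hW, G, H, hr, zpow_zero, zpow_one, q, q0]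
    refine ⟨?_, ?_, ?_, ?_, ?_, ?_, ?_, ?_, ?_⟩ <;> (try field_simp)
  have r0 := rel 0
  have rm := rel (-1)
  have r1 := rel 1
  simp only [show (0 : ℤ) + 1 = 1 from rfl, show (-1 : ℤ) + 1 = 0 from rfl] at r0 rm
  refine sextic_eq_zero_of_bilinear (weightDerivation fun i => k i + k' i) (C p)
    (by simp [weightDerivation]) _ (fun i e => rfl) (fun i e => rfl)
    (g := polyTau K (G 0)) (gp := polyTau K (G 1)) (gm := polyTau K (G (-1)))
    (h := polyTau K (H 0)) (hp' := polyTau K (H 1)) (hm := polyTau K (H (-1)))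
    (polyTau_ne_zero K _) (polyTau_ne_zero K _) ?_ ?_ ?_ ?_ ?_ ?_ ?_
  · have := polyTau_bilinear K (G 0) k k' hK (-p) p h4' h4 (wa := W 0 0) (wb := W 0 1)
      (wab := H 0) (fun i => (r0 i).1) (fun i => (r0 i).2.1) (fun i => (r0 i).2.2.1)
    simp only [Function.iterate_zero, id_eq]
    rw [this, C_neg]; ring
  · have := polyTau_bilinear K (G 1) k k' hK (-p) p h4' h4 (wa := W 1 0) (wb := W 1 1)
      (wab := H 1) (fun i => (r1 i).1) (fun i => (r1 i).2.1) (fun i => (r1 i).2.2.1)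
    simp only [Function.iterate_zero, id_eq]
    rw [this, C_neg]; ring
  · have := polyTau_bilinear K (G (-1)) k k' hK (-p) p h4' h4 (wa := W (-1) 0) (wb := W (-1) 1)
      (wab := H (-1)) (fun i => (rm i).1) (fun i => (rm i).2.1) (fun i => (rm i).2.2.1)
    simp only [Function.iterate_zero, id_eq]
    rw [this, C_neg]; ring
  · have := polyTau_threeTerm K (G 0) k k' hK (-p) p 0 h4' h4 h0' (wa := W 0 0) (wb := W 0 1)
      (wc := G 1) (wab := H 0) (wbc := W 1 1) (wca := W 1 0)
      (fun i => (r0 i).1) (fun i => (r0 i).2.1) (fun i => (r0 i).2.2.2.1)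
      (fun i => (r0 i).2.2.1) (fun i => by rw [(r0 i).2.2.2.2.2.1]; ring)
      (fun i => (r0 i).2.2.2.2.1)
    simp only [Function.iterate_zero, id_eq]
    rw [C_neg, C_0] at this
    linear_combination -this
  · have := polyTau_threeTerm K (G (-1)) k k' hK (-p) p 0 h4' h4 h0' (wa := W (-1) 0)
      (wb := W (-1) 1) (wc := G 0) (wab := H (-1)) (wbc := W 0 1) (wca := W 0 0)
      (fun i => (rm i).1) (fun i => (rm i).2.1) (fun i => (rm i).2.2.2.1)
      (fun i => (rm i).2.2.1) (fun i => by rw [(rm i).2.2.2.2.2.1]; ring)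
      (fun i => (rm i).2.2.2.2.1)
    simp only [Function.iterate_zero, id_eq]
    rw [C_neg, C_0] at this
    linear_combination -this
  · have := polyTau_bilinear K (W 0 0) k k' hK p 0 h4 h0' (wa := H 0) (wb := W 1 0)
      (wab := H 1) (fun i => (r0 i).2.2.2.2.2.2.1) (fun i => (r0 i).2.2.2.2.2.2.2.1)
      (fun i => (r0 i).2.2.2.2.2.2.2.2)
    simp only [Function.iterate_zero, id_eq]
    rw [this, C_0]; ring
  · have := polyTau_bilinear K (G (-1)) k k' hK 0 (-p) h0' h4' (wa := G 0) (wb := W (-1) 0)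
      (wab := W 0 0) (fun i => (rm i).2.2.2.1) (fun i => (rm i).1)
      (fun i => (rm i).2.2.2.2.1)
    simp only [Function.iterate_zero, id_eq]
    rw [this, C_0, C_neg]; ring

/-! ### Squarefree coefficients -/

/-- The exponent of the squarefree monomial with support `S`. -/
noncomputable def sqExp (S : Finset ι) : ι →₀ ℕ := ∑ i ∈ S, Finsupp.single i 1

omit [Fintype ι] in
theorem sqExp_apply (S : Finset ι) (i : ι) : sqExp S i = if i ∈ S then 1 else 0 := by
  simp [sqExp, Finsupp.finsetSum_apply, Finsupp.single_apply]

omit [Fintype ι] in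
/-- A squarefree monomial only factorises according to a partition of its support. -/
theorem coeff_sqExp_mul (P Q : MvPolynomial ι ℂ) (S : Finset ι) :
    coeff (sqExp S) (P * Q)
      = ∑ T ∈ S.powerset, coeff (sqExp T) P * coeff (sqExp (S \ T)) Q := by
  rw [coeff_mul]
  symm
  refine Finset.sum_bij' (fun T _ => (sqExp T, sqExp (S \ T))) (fun q _ => q.1.support)
    ?_ ?_ ?_ ?_ ?_
  · intro T hT
    rw [Finset.mem_powerset] at hT
    rw [Finset.HasAntidiagonal.mem_antidiagonal]
    ext i
    simp only [Finsupp.add_apply, sqExp_apply, Finset.mem_sdiff]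
    by_cases h1 : i ∈ T
    · simp [h1, hT h1]
    · simp [h1]
  · intro q hq
    rw [Finset.HasAntidiagonal.mem_antidiagonal] at hq
    rw [Finset.mem_powerset]
    intro i hi
    have := DFunLike.congr_fun hq i
    rw [Finsupp.add_apply, sqExp_apply] at this
    rw [Finsupp.mem_support_iff] at hi
    by_contra hS
    rw [if_neg hS] at this
    omega
  · intro T hT
    ext i
    simp [sqExp_apply]
  · intro q hq
    rw [Finset.HasAntidiagonal.mem_antidiagonal] at hq
    have h : ∀ i, q.1 i + q.2 i = if i ∈ S then 1 else 0 := fun i => by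
      rw [← sqExp_apply, ← hq, Finsupp.add_apply]
    have h' : ∀ i, (q.1 i = 0 ∨ q.1 i = 1) := fun i => by
      have := h i
      split_ifs at this <;> omega
    refine Prod.ext (Finsupp.ext fun i => ?_) (Finsupp.ext fun i => ?_) <;> have h1 := h i <;>
      simp only [sqExp_apply, Finset.mem_sdiff, Finsupp.mem_support_iff] <;>
      by_cases hS : i ∈ S <;> rcases h' i with h2 | h2 <;> simp [hS, h2] at h1 ⊢ <;> omega
  · intro T hT
    rfl

omit [Fintype ι] in
theorem coeff_sqExp_weightDerivation (κ : ι → ℂ) (P : MvPolynomial ι ℂ) (S : Finset ι) :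
    coeff (sqExp S) (weightDerivation κ P) = (∑ i ∈ S, κ i) * coeff (sqExp S) P := by
  have hmon : ∀ (s : ι →₀ ℕ) (r : ℂ), weightDerivation κ (monomial s r)
      = monomial s ((s.sum fun i m => (m : ℂ) * κ i) * r) := by
    intro s r
    rw [weightDerivation, mkDerivation_monomial, Finsupp.sum, Finsupp.sum, Finset.sum_mul,
      map_sum, Finset.smul_sum]
    refine Finset.sum_congr rfl fun i hi => ?_
    have hi' : s - Finsupp.single i 1 + Finsupp.single i 1 = s :=
      tsub_add_cancel_of_le (by
        rw [Finsupp.single_le_iff]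
        exact Nat.one_le_iff_ne_zero.2 (Finsupp.mem_support_iff.1 hi))
    rw [smul_eq_mul, C_mul_X_eq_monomial, monomial_mul, hi', smul_monomial, smul_eq_mul, mul_comm]
  induction P using MvPolynomial.induction_on' with
  | monomial s r =>
    rw [hmon, coeff_monomial, coeff_monomial]
    split_ifs with h
    · rw [h]
      congr 1
      rw [Finsupp.sum]
      have hsupp : (sqExp S).support = S := by ext i; simp [sqExp_apply]
      rw [hsupp]
      refine Finset.sum_congr rfl fun i hi => ?_
      rw [sqExp_apply, if_pos hi]; simp
    · simp
  | add P Q hP hQ => rw [map_add, coeff_add, coeff_add, hP, hQ, mul_add]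

/-- The squarefree coefficients of `det (1 + diag(w X) K)` are the principal minors of
`diag(w) K`. -/
theorem coeff_sqExp_polyTau (K : Matrix ι ι ℂ) (w : ι → ℂ) (S : Finset ι) :
    coeff (sqExp S) (polyTau K w) = (∏ i ∈ S, w i) * (K.submatrix (fun i : S => i.1)
      (fun i : S => i.1)).det := by
  have h1 : polyTau K w = ∑ T : Finset ι, monomial (sqExp T)
      ((∏ i ∈ T, w i) * (K.submatrix (fun i : T => i.1) (fun i : T => i.1)).det) := by
    rw [polyTau, finTau, add_comm]
    have := (Matrix.detRowAlternating (n := ι) (R := MvPolynomial ι ℂ)).map_add_univ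
      (Matrix.diagonal (fun i => C (w i) * X i) * K.map (C : ℂ →+* MvPolynomial ι ℂ))
      (1 : Matrix ι ι (MvPolynomial ι ℂ))
    refine this.trans (Finset.sum_congr rfl fun T _ => ?_)
    let M : Matrix ι ι (MvPolynomial ι ℂ) := Matrix.of fun i j =>
      if i ∈ T then C (w i) * X i * C (K i j) else (1 : Matrix ι ι (MvPolynomial ι ℂ)) i j
    have hM : T.piecewise (Matrix.diagonal (fun i => C (w i) * X i)
        * K.map (C : ℂ →+* MvPolynomial ι ℂ)) (1 : Matrix ι ι (MvPolynomial ι ℂ)) = M := by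
      ext1 i
      by_cases hi : i ∈ T
      · ext1 j
        simp only [M, Finset.piecewise, hi, if_true, Matrix.of_apply]
        exact Matrix.diagonal_mul _ _ _ _
      · ext1 j
        simp [M, Finset.piecewise, hi]
    refine (congrArg Matrix.detRowAlternating hM).trans ?_
    change M.det = _
    rw [Matrix.twoBlockTriangular_det M (fun i => i ∈ T)]
    · have hB : (Matrix.toSquareBlockProp M fun i => ¬ i ∈ T) = 1 := by
        ext i j
        simp [M, Matrix.toSquareBlockProp, i.2, Matrix.one_apply, Subtype.ext_iff]
      have hA : (Matrix.toSquareBlockProp M fun i => i ∈ T)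
          = Matrix.of fun i j : {i // i ∈ T} => C (w i.1) * X i.1 *
            (K.submatrix (fun i : {i // i ∈ T} => i.1) (fun i => i.1)).map
                (C : ℂ →+* MvPolynomial ι ℂ) i j := by
        ext i j
        simp [M, Matrix.toSquareBlockProp, i.2]
      rw [hA, hB, Matrix.det_one, mul_one,
        Subsingleton.elim (Subtype.fintype fun i => i ∈ T) (Finset.fintypeCoeSort T),
        Matrix.det_mul_column (fun i : {i // i ∈ T} => C (w i.1) * X i.1),
        ← RingHom.mapMatrix_apply, ← RingHom.map_det, Finset.prod_mul_distrib,
        ← Finset.prod_coe_sort T w, ← map_prod]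
      have : ∏ i : {i // i ∈ T}, (X i.1 : MvPolynomial ι ℂ) = monomial (sqExp T) 1 := by
        rw [sqExp, monomial_sum_one]
        exact Finset.prod_coe_sort T fun i => (X i : MvPolynomial ι ℂ)
      rw [this, mul_right_comm, ← C_mul, C_mul_monomial, mul_one]
    · intro i hi j hj
      simp only [M, Matrix.of_apply, hi, if_false]
      exact Matrix.one_apply_ne (fun h => hi (h ▸ hj))
  rw [h1, coeff_sum]
  simp_rw [coeff_monomial]
  have hinj : ∀ T : Finset ι, sqExp T = sqExp S ↔ T = S := fun T =>
    ⟨fun h => by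
      ext i
      have := DFunLike.congr_fun h i
      rw [sqExp_apply, sqExp_apply] at this
      by_cases h1 : i ∈ T <;> by_cases h2 : i ∈ S <;> simp_all, fun h => by rw [h]⟩
  simp_rw [hinj]
  simp

end Poly

/-! ### Integrals over configurations of points -/

section Configuration

variable {X 𝕜 : Type*} [RCLike 𝕜]

/-- The convolution of functions of finite configurations of points: the sum over all ways to
distribute the points of a configuration onto two configurations. -/
def mconv (F G : Multiset X → 𝕜) (s : Multiset X) : 𝕜 :=
  (s.antidiagonal.map fun t => F t.1 * G t.2).sum

/-- For a configuration with labelled points; repeated points are counted with multiplicity. -/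
theorem mconv_map {ι : Type*} [DecidableEq ι] (F G : Multiset X → 𝕜) (z : ι → X)
    (S : Finset ι) :
    mconv F G (S.val.map z)
      = ∑ T ∈ S.powerset, F (T.val.map z) * G ((S \ T).val.map z) := by
  induction S using Finset.induction_on generalizing F G with
  | empty => simp [mconv]
  | insert a S ha ih =>
    have h1 : mconv F G (((insert a S : Finset ι)).val.map z)
        = mconv F (fun s => G (z a ::ₘ s)) (S.val.map z)
          + mconv (fun s => F (z a ::ₘ s)) G (S.val.map z) := by
      rw [Finset.insert_val_of_notMem ha, Multiset.map_cons, mconv, Multiset.antidiagonal_cons]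
      simp [mconv]
    rw [h1, ih, ih, Finset.sum_powerset_insert ha]
    congr 1 <;> refine Finset.sum_congr rfl fun T hT => ?_
    · have haT : a ∉ T := fun h => ha (Finset.mem_powerset.1 hT h)
      rw [Finset.insert_sdiff_of_notMem _ haT, Finset.insert_val_of_notMem (by simp [ha]),
        Multiset.map_cons]
    · have haT : a ∉ T := fun h => ha (Finset.mem_powerset.1 hT h)
      rw [Finset.insert_sdiff_insert, Finset.insert_val_of_notMem haT, Multiset.map_cons,
        Finset.sdiff_insert_of_notMem ha]

variable [MeasurableSpace X] (μ : Measure X) [SigmaFinite μ]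

theorem integral_config_equiv {ι κ : Type*} [Fintype ι] [Fintype κ] (e : ι ≃ κ)
    (F : Multiset X → 𝕜) :
    (Integrable (fun z : κ → X => F (Finset.univ.val.map z)) (Measure.pi fun _ => μ) ↔
      Integrable (fun z : ι → X => F (Finset.univ.val.map z)) (Measure.pi fun _ => μ)) ∧
    ∫ z : κ → X, F (Finset.univ.val.map z) ∂(Measure.pi fun _ => μ)
      = ∫ z : ι → X, F (Finset.univ.val.map z) ∂(Measure.pi fun _ => μ) := by
  have hp := measurePreserving_piCongrLeft (fun _ : κ => μ) e
  have hcomp : ∀ z : ι → X,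
      F (Finset.univ.val.map ((MeasurableEquiv.piCongrLeft (fun _ : κ => X) e) z))
        = F (Finset.univ.val.map z) := by
    intro z
    congr 1
    rw [← Finset.map_univ_equiv e, Finset.map_val, Multiset.map_map]
    refine Multiset.map_congr rfl fun i _ => ?_
    exact MeasurableEquiv.piCongrLeft_apply_apply (β := fun _ : κ => X) e z i
  constructor
  · rw [← hp.integrable_comp_emb (MeasurableEquiv.measurableEmbedding _)]
    exact integrable_congr (Filter.Eventually.of_forall hcomp)
  · rw [← hp.integral_comp']
    exact integral_congr_ae (Filter.Eventually.of_forall hcomp)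

/-- The integral over `Fin m → X` of a function of configurations. -/
noncomputable def configInt (F : Multiset X → 𝕜) (m : ℕ) : 𝕜 :=
  ∫ z : Fin m → X, F (Finset.univ.val.map z) ∂(Measure.pi fun _ => μ)

/-- Fubini for a product of functions of complementary parts of a configuration. -/
theorem integral_config_split {M : ℕ} (T : Finset (Fin M)) (F G : Multiset X → 𝕜)
    (hF : ∀ m, Integrable (fun z : Fin m → X => F (Finset.univ.val.map z))
      (Measure.pi fun _ => μ))
    (hG : ∀ m, Integrable (fun z : Fin m → X => G (Finset.univ.val.map z))
      (Measure.pi fun _ => μ)) :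
    Integrable (fun z : Fin M → X => F (T.val.map z) * G ((Finset.univ \ T).val.map z))
      (Measure.pi fun _ => μ) ∧
    ∫ z : Fin M → X, F (T.val.map z) * G ((Finset.univ \ T).val.map z) ∂(Measure.pi fun _ => μ)
      = configInt μ F T.card * configInt μ G (M - T.card) := by
  classical
  obtain ⟨p, hpT⟩ : ∃ p : Fin M → Prop, ∀ i, p i ↔ i ∈ T := ⟨fun i => i ∈ T, fun _ => Iff.rfl⟩
  have hp := measurePreserving_piEquivPiSubtypeProd (fun _ : Fin M => μ) p
  have hval : ∀ (p : Fin M → Prop) [DecidablePred p] (z : Fin M → X),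
      (Finset.univ : Finset {i // p i}).val.map (fun i => z i.1)
        = (Finset.univ.filter p).val.map z := by
    intro p _ z
    have : (Finset.univ.filter p) = (Finset.univ : Finset {i // p i}).map
        ⟨Subtype.val, Subtype.val_injective⟩ := by ext; simp
    rw [this, Finset.map_val, Multiset.map_map]
    rfl
  have e1 : Finset.univ.filter p = T := by ext; simp [hpT]
  have e2 : (Finset.univ.filter fun i => ¬ p i) = Finset.univ \ T := by ext; simp [hpT]
  have hcomp : ∀ z : Fin M → X,
      (fun q : ({i // p i} → X) × ({i // ¬ p i} → X) =>
        F (Finset.univ.val.map q.1) * G (Finset.univ.val.map q.2))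
        ((MeasurableEquiv.piEquivPiSubtypeProd (fun _ : Fin M => X) p) z)
      = F (T.val.map z) * G ((Finset.univ \ T).val.map z) := by
    intro z
    have h1 := hval p z
    have h2 := hval (fun i => ¬ p i) z
    rw [e1] at h1
    rw [e2] at h2
    rw [← h1, ← h2]
    rfl
  have c1 : Fintype.card {i // p i} = T.card := by
    rw [Fintype.card_subtype, e1]
  have c2 : Fintype.card {i // ¬ p i} = M - T.card := by
    rw [Fintype.card_subtype, e2, Finset.card_sdiff_of_subset (Finset.subset_univ T)]; simp
  have q1 := integral_config_equiv (𝕜 := 𝕜) μ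
    (Fintype.equivFinOfCardEq (α := {i // p i}) c1).symm
  have q2 := integral_config_equiv (𝕜 := 𝕜) μ
    (Fintype.equivFinOfCardEq (α := {i // ¬ p i}) c2).symm
  have i1 := (q1 F).1.2 (hF _)
  have i2 := (q2 G).1.2 (hG _)
  constructor
  · have := (hp.integrable_comp_emb (MeasurableEquiv.measurableEmbedding _)).2 (i1.mul_prod i2)
    exact this.congr (Filter.Eventually.of_forall hcomp)
  · rw [← integral_congr_ae (Filter.Eventually.of_forall hcomp),
      configInt, configInt, ← (q1 F).2, ← (q2 G).2]
    exact (hp.integral_comp' (g := fun q : ({i // p i} → X) × ({i // ¬ p i} → X) =>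
        F (Finset.univ.val.map q.1) * G (Finset.univ.val.map q.2))).trans (integral_prod_mul
        (fun y : {i // p i} → X => F (Finset.univ.val.map y))
        (fun y : {i // ¬ p i} → X => G (Finset.univ.val.map y)))

/-- The function `F` of configurations is absolutely integrable over all configurations, weighted
by `1 / m!` for configurations of `m` points, with integral `v`. -/
structure HasConfigInt (F : Multiset X → ℂ) (v : ℂ) : Prop where
  integrable : ∀ m, Integrable (fun z : Fin m → X => F (Finset.univ.val.map z))
    (Measure.pi fun _ => μ)
  summable : Summable fun m : ℕ => (1 / (m.factorial : ℝ)) * configInt μ (fun s => ‖F s‖) m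
  tsum_eq : ∑' m : ℕ, (1 / (m.factorial : ℂ)) * configInt μ F m = v

variable {μ}

omit [SigmaFinite μ] in
theorem configInt_norm_nonneg (F : Multiset X → ℂ) (m : ℕ) :
    0 ≤ configInt μ (fun s => ‖F s‖) m :=
  integral_nonneg fun _ => norm_nonneg _

omit [SigmaFinite μ] in
theorem norm_configInt_le (F : Multiset X → ℂ) (m : ℕ) :
    ‖(1 / (m.factorial : ℂ)) * configInt μ F m‖
      ≤ (1 / (m.factorial : ℝ)) * configInt μ (fun s => ‖F s‖) m := by
  rw [norm_mul]
  gcongr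
  · simp
  · exact norm_integral_le_integral_norm _

omit [SigmaFinite μ] in
theorem HasConfigInt.summable_norm {F : Multiset X → ℂ} {v : ℂ} (h : HasConfigInt μ F v) :
    Summable fun m : ℕ => ‖(1 / (m.factorial : ℂ)) * configInt μ F m‖ :=
  Summable.of_nonneg_of_le (fun _ => norm_nonneg _) (norm_configInt_le F) h.summable

omit [SigmaFinite μ] in
theorem HasConfigInt.add {F G : Multiset X → ℂ} {v w : ℂ} (hF : HasConfigInt μ F v)
    (hG : HasConfigInt μ G w) : HasConfigInt μ (fun s => F s + G s) (v + w) where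
  integrable m := (hF.integrable m).add (hG.integrable m)
  summable := by
    refine Summable.of_nonneg_of_le (fun m => ?_) (fun m => ?_) (hF.summable.add hG.summable)
    · exact mul_nonneg (by positivity) (configInt_norm_nonneg _ m)
    · rw [← mul_add, configInt, configInt, configInt,
        ← integral_add (hF.integrable m).norm (hG.integrable m).norm]
      refine mul_le_mul_of_nonneg_left (integral_mono ((hF.integrable m).add (hG.integrable m)).norm
        ((hF.integrable m).norm.add (hG.integrable m).norm) fun z => ?_) (by positivity)
      exact norm_add_le _ _
  tsum_eq := by
    rw [← hF.tsum_eq, ← hG.tsum_eq, ← hF.summable_norm.of_norm.tsum_add hG.summable_norm.of_norm]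
    refine tsum_congr fun m => ?_
    rw [← mul_add, configInt, configInt, configInt,
      ← integral_add (hF.integrable m) (hG.integrable m)]

omit [SigmaFinite μ] in
theorem HasConfigInt.const_mul {F : Multiset X → ℂ} {v : ℂ} (hF : HasConfigInt μ F v) (c : ℂ) :
    HasConfigInt μ (fun s => c * F s) (c * v) where
  integrable m := (hF.integrable m).const_mul c
  summable := by
    have h : ∀ m : ℕ, (1 / (m.factorial : ℝ)) * configInt μ (fun s => ‖c * F s‖) m
        = ‖c‖ * ((1 / (m.factorial : ℝ)) * configInt μ (fun s => ‖F s‖) m) := fun m => by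
      simp only [configInt, norm_mul, integral_const_mul]; ring
    simp_rw [h]
    exact hF.summable.mul_left _
  tsum_eq := by
    rw [← hF.tsum_eq, ← tsum_mul_left]
    refine tsum_congr fun m => ?_
    simp only [configInt, integral_const_mul]; ring

/-- There are `M! / (m! (M - m)!)` subsets of `m` elements. -/
theorem sum_powerset_configInt {𝕜 : Type*} [RCLike 𝕜] (a b : ℕ → 𝕜) (M : ℕ) :
    (1 / (M.factorial : 𝕜)) * ∑ T ∈ (Finset.univ : Finset (Fin M)).powerset,
        a T.card * b (M - T.card)
      = ∑ q ∈ Finset.HasAntidiagonal.antidiagonal M, ((1 / (q.1.factorial : 𝕜)) * a q.1)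
          * ((1 / (q.2.factorial : 𝕜)) * b q.2) := by
  rw [Finset.sum_powerset_apply_card (fun m => a m * b (M - m)), Finset.card_univ,
    Fintype.card_fin, Finset.Nat.sum_antidiagonal_eq_sum_range_succ_mk, Finset.mul_sum]
  refine Finset.sum_congr rfl fun m hm => ?_
  have hm' : m ≤ M := Nat.lt_succ_iff.1 (Finset.mem_range.1 hm)
  rw [nsmul_eq_mul, Nat.cast_choose 𝕜 hm']
  have h1 : (M.factorial : 𝕜) ≠ 0 := Nat.cast_ne_zero.2 (Nat.factorial_ne_zero _)
  have h2 : (m.factorial : 𝕜) ≠ 0 := Nat.cast_ne_zero.2 (Nat.factorial_ne_zero _)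
  have h3 : ((M - m).factorial : 𝕜) ≠ 0 := Nat.cast_ne_zero.2 (Nat.factorial_ne_zero _)
  field_simp

/-- The integral over all configurations turns convolutions into products. -/
theorem HasConfigInt.mconv {F G : Multiset X → ℂ} {v w : ℂ} (hF : HasConfigInt μ F v)
    (hG : HasConfigInt μ G w) : HasConfigInt μ (DL.mconv F G) (v * w) := by
  have hs := fun (M : ℕ) (T : Finset (Fin M)) =>
    integral_config_split μ T F G hF.integrable hG.integrable
  have hsn := fun (M : ℕ) (T : Finset (Fin M)) =>
    integral_config_split μ T (fun s => ‖F s‖) (fun s => ‖G s‖)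
      (fun m => (hF.integrable m).norm) (fun m => (hG.integrable m).norm)
  have hint : ∀ m, Integrable (fun z : Fin m → X => DL.mconv F G (Finset.univ.val.map z))
      (Measure.pi fun _ => μ) := by
    intro M
    simp_rw [mconv_map]
    exact integrable_finsetSum _ fun T _ => (hs M T).1
  refine ⟨hint, ?_, ?_⟩
  · have hsum := (summable_norm_sum_mul_antidiagonal_of_summable_norm
      (f := fun m : ℕ => (1 / (m.factorial : ℝ)) * configInt μ (fun s => ‖F s‖) m)
      (g := fun m : ℕ => (1 / (m.factorial : ℝ)) * configInt μ (fun s => ‖G s‖) m)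
      hF.summable.norm hG.summable.norm).of_norm
    refine Summable.of_nonneg_of_le
      (fun m => mul_nonneg (by positivity) (configInt_norm_nonneg _ m)) (fun M => ?_) hsum
    rw [← sum_powerset_configInt]
    refine mul_le_mul_of_nonneg_left ?_ (by positivity)
    rw [← Finset.sum_congr rfl fun T _ => (hsn M T).2,
      ← integral_finsetSum _ fun T _ => (hsn M T).1]
    refine integral_mono (hint M).norm (integrable_finsetSum _ fun T _ => (hsn M T).1) ?_
    intro z
    simp only [mconv_map]
    exact (norm_sum_le _ _).trans (Finset.sum_le_sum fun T _ => (norm_mul _ _).le)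
  · rw [← hF.tsum_eq, ← hG.tsum_eq,
      tsum_mul_tsum_eq_tsum_sum_antidiagonal_of_summable_norm hF.summable_norm hG.summable_norm]
    refine tsum_congr fun M => ?_
    rw [← sum_powerset_configInt, ← Finset.sum_congr rfl fun T _ => (hs M T).2,
      ← integral_finsetSum _ fun T _ => (hs M T).1, configInt]
    simp_rw [mconv_map]

end Configuration

/-! ### Laplace series -/

/-- Termwise differentiation of a series of integrals of functions proportional to
`exp (t κ)`.  The integrand at a time between `t₁` and `t₂` is dominated by the sum of those at
`t₁` and `t₂`. -/
theorem hasDerivAt_laplaceSeries {α : ℕ → Type*} [∀ m, MeasurableSpace (α m)]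
    (ν : ∀ m, Measure (α m)) (κ : ∀ m, α m → ℂ) (Φ : ℝ → ∀ m, α m → ℂ)
    (hΦ : ∀ s t m, ∀ᵐ z ∂ν m, Φ t m z = Complex.exp (((t - s : ℝ) : ℂ) * κ m z) * Φ s m z)
    {J : Set ℝ} (hJ : IsOpen J)
    (H : ∀ t ∈ J, ∀ j ≤ 2, (∀ m, Integrable (fun z => κ m z ^ j * Φ t m z) (ν m)) ∧
      Summable fun m : ℕ => (1 / (m.factorial : ℝ)) * ∫ z, ‖κ m z ^ j * Φ t m z‖ ∂ν m)
    (T : ℕ → ℝ → ℂ)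
    (hT : ∀ j t, T j t = ∑' m : ℕ, (1 / (m.factorial : ℂ)) * ∫ z, κ m z ^ j * Φ t m z ∂ν m) :
    (∀ j < 2, ∀ t ∈ J, HasDerivAt (T j) (T (j + 1) t) t) ∧ ContinuousOn (T 2) J := by
  have main : ∀ t₀ ∈ J, (∀ j < 2, HasDerivAt (T j) (T (j + 1) t₀) t₀) ∧
      ContinuousAt (T 2) t₀ := by
    intro t₀ ht₀
    obtain ⟨ε, hε, hball⟩ := Metric.isOpen_iff.1 hJ t₀ ht₀
    set t₁ := t₀ - ε / 2 with ht₁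
    set t₂ := t₀ + ε / 2 with ht₂
    have hI : Set.Icc t₁ t₂ ⊆ J := fun t ht => hball (by
      rw [Metric.mem_ball, Real.dist_eq, abs_lt]
      constructor <;> linarith [ht.1, ht.2])
    have h1 : t₁ ∈ J := hI ⟨le_refl _, by linarith⟩
    have h2 : t₂ ∈ J := hI ⟨by linarith, le_refl _⟩
    let F : ℕ → ℝ → ∀ m, α m → ℂ := fun j t m z =>
      κ m z ^ j * (Complex.exp (((t - t₀ : ℝ) : ℂ) * κ m z) * Φ t₀ m z)
    have hF : ∀ j t m, (fun z => κ m z ^ j * Φ t m z) =ᵐ[ν m] F j t m := fun j t m => by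
      filter_upwards [hΦ t₀ t m] with z hz
      simp only [F, hz]
    let B : ℕ → ∀ m, α m → ℝ := fun j m z => ‖κ m z ^ j * Φ t₁ m z‖ + ‖κ m z ^ j * Φ t₂ m z‖
    have hB : ∀ j m, ∀ᵐ z ∂ν m, ∀ t ∈ Set.Icc t₁ t₂, ‖F j t m z‖ ≤ B j m z := by
      intro j m
      filter_upwards [hΦ t₀ t₁ m, hΦ t₀ t₂ m] with z hz1 hz2 t ht
      simp only [F, B, hz1, hz2, norm_mul, Complex.norm_exp, Complex.re_ofReal_mul]
      rw [← mul_add, ← add_mul]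
      refine mul_le_mul_of_nonneg_left (mul_le_mul_of_nonneg_right ?_ (norm_nonneg _))
        (norm_nonneg _)
      rcases le_total 0 (κ m z).re with h | h
      · refine (Real.exp_le_exp.2 ?_).trans (le_add_of_nonneg_left (Real.exp_nonneg _))
        exact mul_le_mul_of_nonneg_right (by linarith [ht.2]) h
      · refine (Real.exp_le_exp.2 ?_).trans (le_add_of_nonneg_right (Real.exp_nonneg _))
        exact mul_le_mul_of_nonpos_right (by linarith [ht.1]) h
    have hBint : ∀ j ≤ 2, ∀ m, Integrable (B j m) (ν m) := fun j hj m =>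
      ((H t₁ h1 j hj).1 m).norm.add ((H t₂ h2 j hj).1 m).norm
    let u : ℕ → ℕ → ℝ := fun j m => (1 / (m.factorial : ℝ)) * ∫ z, B j m z ∂ν m
    have hu : ∀ j ≤ 2, Summable (u j) := by
      intro j hj
      refine ((H t₁ h1 j hj).2.add (H t₂ h2 j hj).2).congr fun m => ?_
      simp only [u, B]
      rw [integral_add ((H t₁ h1 j hj).1 m).norm ((H t₂ h2 j hj).1 m).norm]
      ring
    have hFint : ∀ j ≤ 2, ∀ t ∈ Set.Icc t₁ t₂, ∀ m, Integrable (F j t m) (ν m) :=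
      fun j hj t ht m => ((H t (hI ht) j hj).1 m).congr (hF j t m)
    let g : ℕ → ℕ → ℝ → ℂ := fun j m t => (1 / (m.factorial : ℂ)) * ∫ z, F j t m z ∂ν m
    have hg : ∀ j, T j = fun t => ∑' m, g j m t := by
      intro j
      funext t
      rw [hT]
      exact tsum_congr fun m => by rw [integral_congr_ae (hF j t m)]
    have hgu : ∀ j ≤ 2, ∀ m, ∀ t ∈ Set.Icc t₁ t₂, ‖g j m t‖ ≤ u j m := by
      intro j hj m t ht
      simp only [g, u, norm_mul]
      refine mul_le_mul (by simp) ?_ (norm_nonneg _) (by positivity)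
      refine norm_integral_le_of_norm_le (hBint j hj m) ?_
      filter_upwards [hB j m] with z hz using hz t ht
    have hnhds : Set.Ioo t₁ t₂ ∈ nhds t₀ := Ioo_mem_nhds (by linarith) (by linarith)
    have hsub : Set.Ioo t₁ t₂ ⊆ Set.Icc t₁ t₂ := Set.Ioo_subset_Icc_self
    have ht₀' : t₀ ∈ Set.Ioo t₁ t₂ := ⟨by linarith, by linarith⟩
    constructor
    · intro j hj
      have hd : ∀ m, ∀ t ∈ Set.Ioo t₁ t₂, HasDerivAt (g j m) (g (j + 1) m t) t := by
        intro m t ht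
        refine HasDerivAt.const_mul _ ?_
        refine (hasDerivAt_integral_of_dominated_loc_of_deriv_le
          (F := fun t z => F j t m z) (F' := fun t z => F (j + 1) t m z)
          (isOpen_Ioo.mem_nhds ht)
          (Filter.eventually_of_mem (isOpen_Ioo.mem_nhds ht) fun s hs =>
            (hFint j (by omega) s (hsub hs) m).aestronglyMeasurable)
          (hFint j (by omega) t (hsub ht) m)
          (hFint (j + 1) (by omega) t (hsub ht) m).aestronglyMeasurable
          ?_ (hBint (j + 1) (by omega) m) ?_).2
        · filter_upwards [hB (j + 1) m] with z hz s hs using hz s (hsub hs)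
        · refine Filter.Eventually.of_forall fun z s _ => ?_
          have hlin : HasDerivAt (fun s : ℝ => ((s - t₀ : ℝ) : ℂ) * κ m z) (κ m z) s := by
            have := ((hasDerivAt_id s).sub_const t₀).ofReal_comp.mul_const (κ m z)
            simpa using this
          have := (hlin.cexp.mul_const (Φ t₀ m z)).const_mul (κ m z ^ j)
          refine this.congr_deriv ?_
          simp only [F, pow_succ]; ring
      rw [hg j, hg (j + 1)]
      exact hasDerivAt_tsum_of_isPreconnected (hu (j + 1) (by omega)) isOpen_Ioo
        isPreconnected_Ioo hd (fun m t ht => hgu (j + 1) (by omega) m t (hsub ht)) ht₀'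
        (Summable.of_norm_bounded (hu j (by omega)) fun m => hgu j (by omega) m t₀ (hsub ht₀'))
        ht₀'
    · rw [hg 2]
      refine ContinuousOn.continuousAt ?_ hnhds
      refine continuousOn_tsum (fun m => ?_) (hu 2 le_rfl)
        fun m t ht => hgu 2 le_rfl m t (hsub ht)
      refine continuousOn_const.mul (continuousOn_of_dominated (bound := B 2 m)
        (fun t ht => (hFint 2 le_rfl t (hsub ht) m).aestronglyMeasurable) (fun t ht => ?_)
        (hBint 2 le_rfl m) (Filter.Eventually.of_forall fun z => ?_))
      · filter_upwards [hB 2 m] with z hz using hz t (hsub ht)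
      · refine Continuous.continuousOn ?_
        simp only [F]
        fun_prop
  exact ⟨fun j hj t ht => (main t ht).1 j hj, fun t ht => (main t ht).2.continuousWithinAt⟩

/-! ### The weights of the tau function -/

/-- The common factor of `ρ_n` and `σ_n`. -/
noncomputable def planeWave (p : ℕ → ℂ) (x : ℕ → ℝ) (N : ℕ → ℤ) (k : ℂ) : ℂ :=
  Complex.exp (∑' j : ℕ, k ^ (2 * j + 1) * (x j : ℂ)) *
    ∏' i : ℕ, ((p i + k) / (p i - k)) ^ (N i)

/-- The dependence of the plane waves on `x₁` and `n₁`. -/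
theorem exists_planeWave_update (p : ℕ → ℂ) (x : ℕ → ℝ) (N : ℕ → ℤ) (k : ℂ)
    (h1 : p 0 + k ≠ 0) (h2 : p 0 - k ≠ 0)
    (hs : Summable fun j : ℕ => k ^ (2 * j + 1) * (x j : ℂ))
    (hm : Multipliable fun i : ℕ => ((p i + k) / (p i - k)) ^ (N i)) :
    ∃ R : ℂ, ∀ (t : ℝ) (n₁ : ℤ),
      planeWave p (Function.update x 0 t) (Function.update N 0 n₁) k
        = Complex.exp (t * k) * ((p 0 + k) / (p 0 - k)) ^ n₁ * R := by
  have hA : (p 0 + k) / (p 0 - k) ≠ 0 := div_ne_zero h1 h2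
  refine ⟨Complex.exp ((∑' j : ℕ, k ^ (2 * j + 1) * (x j : ℂ)) - k * x 0) *
    (((p 0 + k) / (p 0 - k)) ^ (-N 0) * ∏' i : ℕ, ((p i + k) / (p i - k)) ^ (N i)),
    fun t n₁ => ?_⟩
  have e1 : (fun j : ℕ => k ^ (2 * j + 1) * ((Function.update x 0 t j : ℝ) : ℂ))
      = Function.update (fun j : ℕ => k ^ (2 * j + 1) * (x j : ℂ)) 0 (k * t) := by
    funext j
    rcases eq_or_ne j 0 with rfl | hj
    · simp
    · simp [hj]
  have e2 : (fun i : ℕ => ((p i + k) / (p i - k)) ^ (Function.update N 0 n₁ i))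
      = fun i => (if i = 0 then ((p 0 + k) / (p 0 - k)) ^ (n₁ - N 0) else 1)
        * ((p i + k) / (p i - k)) ^ (N i) := by
    funext i
    rcases eq_or_ne i 0 with rfl | hi
    · simp [zpow_sub₀ hA]
      rw [div_mul_cancel₀ _ (zpow_ne_zero _ hA)]
    · simp [hi]
  have t1 : ∑' j : ℕ, k ^ (2 * j + 1) * ((Function.update x 0 t j : ℝ) : ℂ)
      = t * k + ((∑' j : ℕ, k ^ (2 * j + 1) * (x j : ℂ)) - k * x 0) := by
    rw [e1, (hs.hasSum.update 0 (k * t)).tsum_eq]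
    simp; ring
  have t2 : ∏' i : ℕ, ((p i + k) / (p i - k)) ^ (Function.update N 0 n₁ i)
      = ((p 0 + k) / (p 0 - k)) ^ (n₁ - N 0) * ∏' i : ℕ, ((p i + k) / (p i - k)) ^ (N i) := by
    rw [e2]
    exact ((hasProd_ite_eq 0 (((p 0 + k) / (p 0 - k)) ^ (n₁ - N 0))).mul hm.hasProd).tprod_eq
  rw [planeWave, t1, t2, Complex.exp_add, zpow_sub₀ hA, zpow_neg]
  ring

/-- The weight of a point `(k, k')` in the tau function. -/
noncomputable def weight (Z : SpectralMeasure) (p : ℕ → ℂ) (x : ℕ → ℝ) (N : ℕ → ℤ) (n n₁ : ℤ)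
    (t : ℝ) (z : ℂ × ℂ) : ℂ :=
  rho p (Function.update x 0 t) (Function.update N 0 n₁) n z.1 *
    sigma p (Function.update x 0 t) (Function.update N 0 n₁) n z.2 * Z.density z

/-- The dependence of the weights on `n`, `n₁` and `x₁`. -/
theorem weight_shift {Z : SpectralMeasure} {p : ℕ → ℂ} {x : ℕ → ℝ} {N : ℕ → ℤ}
    (hreg : Regular Z p x N) {z : ℂ × ℂ} (hz : z ∈ Z.domain) (n n₁ i e : ℤ) (s t : ℝ) :
    weight Z p x N (n + i) (n₁ + e) t z = Complex.exp (((t - s : ℝ) : ℂ) * (z.1 + z.2)) *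
      (weight Z p x N n n₁ s z * (z.1 / (-z.2)) ^ i *
        ((p 0 + z.1) / (p 0 - z.1) * ((p 0 + z.2) / (p 0 - z.2))) ^ e) := by
  obtain ⟨R, hR⟩ := exists_planeWave_update p x N z.1 (hreg.add_ne z hz 0).1
    (hreg.sub_ne z hz 0).1 (hreg.summable z hz).1 (hreg.multipliable z hz).1
  obtain ⟨R', hR'⟩ := exists_planeWave_update p x N z.2 (hreg.add_ne z hz 0).2
    (hreg.sub_ne z hz 0).2 (hreg.summable z hz).2 (hreg.multipliable z hz).2
  have hw : ∀ n n₁ t, weight Z p x N n n₁ t z =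
      planeWave p (Function.update x 0 t) (Function.update N 0 n₁) z.1 * z.1 ^ n *
      (planeWave p (Function.update x 0 t) (Function.update N 0 n₁) z.2 * (-z.2) ^ (-n))
        * Z.density z := fun _ _ _ => rfl
  have hA : (p 0 + z.1) / (p 0 - z.1) ≠ 0 :=
    div_ne_zero (hreg.add_ne z hz 0).1 (hreg.sub_ne z hz 0).1
  have hB : (p 0 + z.2) / (p 0 - z.2) ≠ 0 :=
    div_ne_zero (hreg.add_ne z hz 0).2 (hreg.sub_ne z hz 0).2
  have hk := (hreg.ne_zero z hz).1
  have hk' : -z.2 ≠ 0 := neg_ne_zero.2 (hreg.ne_zero z hz).2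
  have he : Complex.exp (t * z.1) * Complex.exp (t * z.2)
      = Complex.exp (((t - s : ℝ) : ℂ) * (z.1 + z.2))
        * (Complex.exp (s * z.1) * Complex.exp (s * z.2)) := by
    rw [← Complex.exp_add, ← Complex.exp_add, ← Complex.exp_add]
    congr 1; push_cast; ring
  simp only [hw, hR, hR', neg_add, zpow_add₀ hA, zpow_add₀ hB, zpow_add₀ hk, zpow_add₀ hk',
    mul_zpow, div_zpow, zpow_neg]
  linear_combination (((p 0 + z.1) ^ n₁ / (p 0 - z.1) ^ n₁) * ((p 0 + z.1) ^ e / (p 0 - z.1) ^ e)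
    * R * (z.1 ^ n * z.1 ^ i) * (((p 0 + z.2) ^ n₁ / (p 0 - z.2) ^ n₁)
    * ((p 0 + z.2) ^ e / (p 0 - z.2) ^ e) * R' * (((-z.2) ^ n)⁻¹ * ((-z.2) ^ i)⁻¹)) * Z.density z)
    * he

/-! ### The sextic equation for the tau function -/

/-- The points of a configuration, with multiplicity, are labelled by the labels it is built
from. -/
theorem exists_equiv_toType {ι X : Type*} [Fintype ι] [DecidableEq X] (z : ι → X) :
    ∃ e : ι ≃ (Finset.univ.val.map z).ToType, ∀ i, (e i).1 = z i := by
  classical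
  let f : (Finset.univ : Finset ι).val.ToType → ι := fun v => v.1
  have hf : Function.Bijective f := by
    constructor
    · rintro ⟨a, i, hi⟩ ⟨b, j, hj⟩ (rfl : a = b)
      rw [Multiset.count_univ] at hi hj
      have : i = j := by omega
      subst this
      rfl
    · intro a
      exact ⟨⟨a, 0, by rw [Multiset.count_univ]; exact one_pos⟩, rfl⟩
  refine ⟨(Equiv.ofBijective f hf).symm.trans (Multiset.mapEquiv _ z), fun i => ?_⟩
  rw [Equiv.trans_apply, Multiset.mapEquiv_apply]
  congr 1
  exact (Equiv.ofBijective f hf).apply_symm_apply i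

open Classical in
/-- The integrand, as a function of the configuration `s`, of the `j`-th derivative of the tau
function with the weights `ω`. -/
noncomputable def jetFam (ω : ℂ × ℂ → ℂ) (j : ℕ) (s : Multiset (ℂ × ℂ)) : ℂ :=
  (s.map fun y => y.1 + y.2).sum ^ j *
    ((s.map ω).prod * Matrix.det (n := s.ToType) fun a b => kernel a.1.1 b.1.2)

open Classical in
theorem jetFam_map {ι : Type*} [Fintype ι] [DecidableEq ι] (ω : ℂ × ℂ → ℂ) (j : ℕ)
    (z : ι → ℂ × ℂ) :
    jetFam ω j (Finset.univ.val.map z) = (∑ a, ((z a).1 + (z a).2)) ^ j *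
      ((∏ a, ω (z a)) * (Matrix.of fun a b : ι => kernel (z a).1 (z b).2).det) := by
  obtain ⟨e, he⟩ := exists_equiv_toType z
  have h1 : Matrix.det (n := (Finset.univ.val.map z).ToType) (fun a b => kernel a.1.1 b.1.2)
      = (Matrix.of fun a b : ι => kernel (z a).1 (z b).2).det := by
    refine (Matrix.det_submatrix_equiv_self e (fun a b => kernel a.1.1 b.1.2)).symm.trans
      (congrArg (Matrix.det (n := ι) (R := ℂ)) (Matrix.ext fun a b => ?_))
    exact congrArg₂ kernel (congrArg Prod.fst (he a)) (congrArg Prod.snd (he b))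
  rw [jetFam, h1, Multiset.map_map, Multiset.map_map]
  rfl

theorem jetFam_map_finset {ι : Type*} [DecidableEq ι] (ω : ℂ × ℂ → ℂ) (j : ℕ)
    (z : ι → ℂ × ℂ) (S : Finset ι) :
    jetFam ω j (S.val.map z) = (∑ a ∈ S, ((z a).1 + (z a).2)) ^ j *
      ((∏ a ∈ S, ω (z a)) * (Matrix.of fun a b : S => kernel (z a).1 (z b).2).det) := by
  have h := jetFam_map ω j (fun a : S => z a.1)
  have h2 : (Finset.univ : Finset S).val.map (fun a : S => z a.1) = S.val.map z := by
    rw [Finset.univ_eq_attach, Finset.attach_val]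
    exact Multiset.attach_map_val' S.val z
  rw [h2] at h
  rw [h, Finset.sum_coe_sort S fun a => (z a).1 + (z a).2,
    Finset.prod_coe_sort S fun a => ω (z a)]

section Represents

variable {X : Type*} [MeasurableSpace X] (μ : Measure X) (D : Set X)

/-- The number `v` is the integral of a function of configurations whose value at a configuration
in `D` is given by the squarefree coefficients of the polynomials `P`. -/
def Represents (v : ℂ) (P : ∀ M : ℕ, (Fin M → X) → MvPolynomial (Fin M) ℂ) : Prop :=
  ∃ F : Multiset X → ℂ, HasConfigInt μ F v ∧ ∀ (M : ℕ) (z : Fin M → X), (∀ i, z i ∈ D) →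
    ∀ S : Finset (Fin M), F (S.val.map z) = MvPolynomial.coeff (sqExp S) (P M z)

variable {μ D} {v w : ℂ} {P Q : ∀ M : ℕ, (Fin M → X) → MvPolynomial (Fin M) ℂ}

theorem Represents.add (hP : Represents μ D v P) (hQ : Represents μ D w Q) :
    Represents μ D (v + w) (fun M z => P M z + Q M z) := by
  obtain ⟨F, hF, hF'⟩ := hP
  obtain ⟨G, hG, hG'⟩ := hQ
  refine ⟨_, hF.add hG, fun M z hz S => ?_⟩
  rw [MvPolynomial.coeff_add, hF' M z hz, hG' M z hz]

theorem Represents.const_mul (hP : Represents μ D v P) (c : ℂ) :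
    Represents μ D (c * v) (fun M z => MvPolynomial.C c * P M z) := by
  obtain ⟨F, hF, hF'⟩ := hP
  refine ⟨_, hF.const_mul c, fun M z hz S => ?_⟩
  rw [MvPolynomial.coeff_C_mul, hF' M z hz]

theorem Represents.sub (hP : Represents μ D v P) (hQ : Represents μ D w Q) :
    Represents μ D (v - w) (fun M z => P M z - Q M z) := by
  have := hP.add (hQ.const_mul (-1))
  simpa only [MvPolynomial.C_neg, MvPolynomial.C_1, neg_mul, one_mul, ← sub_eq_add_neg] using this

/-- A product is represented by the convolution. -/
theorem Represents.mul [SigmaFinite μ] (hP : Represents μ D v P) (hQ : Represents μ D w Q) :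
    Represents μ D (v * w) (fun M z => P M z * Q M z) := by
  obtain ⟨F, hF, hF'⟩ := hP
  obtain ⟨G, hG, hG'⟩ := hQ
  refine ⟨_, hF.mconv hG, fun M z hz S => ?_⟩
  rw [coeff_sqExp_mul, mconv_map]
  exact Finset.sum_congr rfl fun T _ => by rw [hF' M z hz, hG' M z hz]

theorem ae_forall_mem_pi {X : Type*} [MeasurableSpace X] (μ : Measure X) [SigmaFinite μ]
    {D : Set X} (hD : MeasurableSet D) (M : ℕ) :
    ∀ᵐ z : Fin M → X ∂(Measure.pi fun _ => μ.restrict D), ∀ i, z i ∈ D := by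
  rw [← Measure.restrict_pi_pi]
  filter_upwards [ae_restrict_mem (MeasurableSet.univ_pi fun _ => hD)] with z hz i
  exact hz i (Set.mem_univ i)

theorem Represents.eq_zero {μ : Measure X} [SigmaFinite μ] (hD : MeasurableSet D)
    (hP : Represents (μ.restrict D) D v P)
    (h0 : ∀ (M : ℕ) (z : Fin M → X), (∀ i, z i ∈ D) → P M z = 0) : v = 0 := by
  obtain ⟨F, hF, hF'⟩ := hP
  rw [← hF.tsum_eq]
  refine (tsum_congr fun m => ?_).trans tsum_zero
  rw [configInt, integral_eq_zero_of_ae, mul_zero]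
  filter_upwards [ae_forall_mem_pi μ hD m] with z hz
  rw [hF' m z hz, h0 m z hz, MvPolynomial.coeff_zero, Pi.zero_apply]

theorem Represents.sextic [SigmaFinite μ] (p : ℂ) {v : ℤ → ℤ → ℕ → ℂ}
    {P : ℤ → ℤ → ℕ → ∀ M : ℕ, (Fin M → X) → MvPolynomial (Fin M) ℂ}
    (h : ∀ i e, ∀ j ≤ 2, Represents μ D (v i e j) (P i e j)) :
    Represents μ D (sextic p v)
      (fun M z => DL.sextic (MvPolynomial.C p) fun i e j => P i e j M z) := by
  have h2 : ∀ M, (2 * MvPolynomial.C p : MvPolynomial (Fin M) ℂ) = MvPolynomial.C (2 * p) :=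
    fun M => by rw [MvPolynomial.C_mul]; rfl
  have h0 := fun i e => h i e 0 (by omega)
  have h1 := fun i e => h i e 1 (by omega)
  have h3 := fun i e => h i e 2 (by omega)
  have hX := fun i : ℤ => ((h0 i 0).mul (h0 0 1)).add ((h0 i 1).mul (h0 0 0))
  have hZ := fun i : ℤ => (((h1 i 0).mul (h0 0 1)).add ((h0 0 0).mul (h1 i 1))).sub
    (((h0 0 0).mul (h0 i 1)).const_mul (2 * p))
  have hY := (((h1 0 0).mul (h0 0 1)).sub ((h0 0 0).mul (h1 0 1))).add
    (((h0 0 0).mul (h0 0 1)).const_mul (2 * p))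
  have hY' := (((h3 0 0).mul (h0 0 1)).sub ((h0 0 0).mul (h3 0 1))).add
    ((((h1 0 0).mul (h0 0 1)).add ((h0 0 0).mul (h1 0 1))).const_mul (2 * p))
  unfold DL.sextic
  simp only [h2]
  exact ((hY'.mul (hX 1)).mul (hX (-1))).sub (hY.mul ((((hZ 1).mul (hX (-1))).add
    ((hZ (-1)).mul (hX 1))).add (((hX 1).mul (hX (-1))).const_mul (2 * p))))

end Represents

/-- The termwise `j`-th derivative of the tau function. -/
noncomputable def tauJet (Z : SpectralMeasure) (p : ℕ → ℂ) (x : ℕ → ℝ) (N : ℕ → ℤ)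
    (n n₁ : ℤ) (j : ℕ) (t : ℝ) : ℂ :=
  ∑' m : ℕ, (1 / (m.factorial : ℂ)) * ∫ z, (∑ a, ((z a).1 + (z a).2)) ^ j *
    tauIntegrand Z p (Function.update x 0 t) (Function.update N 0 n₁) n m z ∂(baseProd Z m)

theorem tauIntegrand_eq (Z : SpectralMeasure) (p : ℕ → ℂ) (x : ℕ → ℝ) (N : ℕ → ℤ)
    (n n₁ : ℤ) (t : ℝ) (j m : ℕ) (z : Fin m → ℂ × ℂ) :
    (∑ a, ((z a).1 + (z a).2)) ^ j *
      tauIntegrand Z p (Function.update x 0 t) (Function.update N 0 n₁) n m z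
    = jetFam (weight Z p x N n n₁ t) j (Finset.univ.val.map z) := by
  rw [jetFam_map]; rfl

theorem hasConfigInt_jetFam (Z : SpectralMeasure) (p : ℕ → ℂ) (x : ℕ → ℝ) (N : ℕ → ℤ)
    (n n₁ : ℤ) (t : ℝ)
    (h : TauConverges Z p (Function.update x 0 t) (Function.update N 0 n₁) n)
    (j : ℕ) (hj : j ≤ 2) :
    HasConfigInt (Z.base.restrict Z.domain) (jetFam (weight Z p x N n n₁ t) j)
      (tauJet Z p x N n n₁ j t) := by
  have h' := h j hj
  simp only [tauIntegrand_eq] at h'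
  refine ⟨h'.1, h'.2, ?_⟩
  simp only [tauJet, tauIntegrand_eq]
  rfl

/-- The polynomials that represent the jets of `τ` satisfy the sextic equation. -/
theorem sextic_tauJet (Z : SpectralMeasure) [SigmaFinite Z.base] (p : ℕ → ℂ) (x : ℕ → ℝ)
    (N : ℕ → ℤ) (hreg : Regular Z p x N) (t : ℝ)
    (hconv : ∀ n n₁ : ℤ, TauConverges Z p (Function.update x 0 t) (Function.update N 0 n₁) n)
    (n n₁ : ℤ) :
    sextic (p 0) (fun i e j => tauJet Z p x N (n + i) (n₁ + e) j t) = 0 := by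
  let W : ℤ → ℤ → ∀ M : ℕ, (Fin M → ℂ × ℂ) → Fin M → ℂ := fun i e M z a =>
    weight Z p x N n n₁ t (z a) * ((z a).1 / (-(z a).2)) ^ i *
      ((p 0 + (z a).1) / (p 0 - (z a).1) * ((p 0 + (z a).2) / (p 0 - (z a).2))) ^ e
  refine Represents.eq_zero (μ := Z.base) (D := Z.domain) hreg.measurable_domain
    (Represents.sextic (p 0)
      (P := fun i e j M z => (weightDerivation fun a => (z a).1 + (z a).2)^[j]
        (polyTau (Matrix.of fun a b => kernel (z a).1 (z b).2) (W i e M z)))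
      fun i e j hj => ⟨_, hasConfigInt_jetFam Z p x N (n + i) (n₁ + e) t (hconv _ _) j hj,
        fun M z hz S => ?_⟩) fun M z hz => ?_
  · have hder : ∀ j, MvPolynomial.coeff (sqExp S)
        ((weightDerivation fun a => (z a).1 + (z a).2)^[j]
          (polyTau (Matrix.of fun a b => kernel (z a).1 (z b).2) (W i e M z)))
        = (∑ a ∈ S, ((z a).1 + (z a).2)) ^ j * MvPolynomial.coeff (sqExp S)
          (polyTau (Matrix.of fun a b => kernel (z a).1 (z b).2) (W i e M z)) := by
      intro j
      induction j with
      | zero => simp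
      | succ j ih =>
        rw [Function.iterate_succ_apply', coeff_sqExp_weightDerivation, ih, pow_succ]; ring
    rw [hder, coeff_sqExp_polyTau, jetFam_map_finset]
    congr 2
    refine Finset.prod_congr rfl fun a _ => ?_
    rw [weight_shift hreg (hz a) n n₁ i e t t]
    simp [W]
  · refine sextic_polyTau _ (fun a => weight Z p x N n n₁ t (z a)) (fun a => (z a).1)
      (fun a => (z a).2) (p 0) (fun a b => ?_) (fun a => (hreg.ne_zero _ (hz a)).1)
      (fun a => (hreg.ne_zero _ (hz a)).2) (fun a => (hreg.add_ne _ (hz a) 0).1)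
      (fun a => (hreg.add_ne _ (hz a) 0).2) (fun a => (hreg.sub_ne _ (hz a) 0).1)
      (fun a => (hreg.sub_ne _ (hz a) 0).2) (fun i e => W i e M z) (fun i e a => rfl)
    rw [Matrix.of_apply, kernel, mul_one_div_cancel (hreg.kernel_ne _ (hz a) _ (hz b))]

/-- On the domain, the integrands depend on `x₁` by a factor `exp (x₁ ∑ (k + k'))`. -/
theorem tauJet_smooth (Z : SpectralMeasure) [SigmaFinite Z.base] (p : ℕ → ℂ) (x : ℕ → ℝ)
    (N : ℕ → ℤ) (hreg : Regular Z p x N) (J : Set ℝ) (hJ : IsOpen J) (n n₁ : ℤ)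
    (hconv : ∀ t ∈ J, TauConverges Z p (Function.update x 0 t) (Function.update N 0 n₁) n) :
    (∀ j < 2, ∀ t ∈ J,
      HasDerivAt (tauJet Z p x N n n₁ j) (tauJet Z p x N n n₁ (j + 1) t) t) ∧
    ContinuousOn (tauJet Z p x N n n₁ 2) J := by
  refine hasDerivAt_laplaceSeries (fun m => baseProd Z m)
    (fun m (z : Fin m → ℂ × ℂ) => ∑ a, ((z a).1 + (z a).2))
    (fun t m z => tauIntegrand Z p (Function.update x 0 t) (Function.update N 0 n₁) n m z)
    (fun s t m => ?_) hJ (fun t ht j hj => hconv t ht j hj) (tauJet Z p x N n n₁)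
    (fun j t => rfl)
  filter_upwards [ae_forall_mem_pi Z.base hreg.measurable_domain m] with z hz
  have h : ∀ a, weight Z p x N n n₁ t (z a)
      = Complex.exp (((t - s : ℝ) : ℂ) * ((z a).1 + (z a).2)) * weight Z p x N n n₁ s (z a) :=
    fun a => by simpa using weight_shift hreg (hz a) n n₁ 0 0 s t
  change (∏ a, weight Z p x N n n₁ t (z a)) * _ = _ * ((∏ a, weight Z p x N n n₁ s (z a)) * _)
  rw [← mul_assoc, Finset.mul_sum, Complex.exp_sum, ← Finset.prod_mul_distrib,
    Finset.prod_congr rfl fun a _ => h a]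

/-! ### The equation in polynomial form -/

/-- The function `f` is twice differentiable at `t`, with `f t = a₀`, `f' t = a₁`, `f'' t = a₂`. -/
def HasJet (f : ℝ → ℂ) (t : ℝ) (a₀ a₁ a₂ : ℂ) : Prop :=
  f t = a₀ ∧ ∃ f' : ℝ → ℂ, (∀ᶠ s in nhds t, HasDerivAt f (f' s) s) ∧ f' t = a₁ ∧
    HasDerivAt f' a₂ t

theorem HasJet.hasDerivAt {f : ℝ → ℂ} {t : ℝ} {a₀ a₁ a₂ : ℂ} (h : HasJet f t a₀ a₁ a₂) :
    HasDerivAt f a₁ t := by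
  obtain ⟨_, f', h1, rfl, _⟩ := h
  exact h1.self_of_nhds

theorem HasJet.logDeriv {f : ℝ → ℂ} {t : ℝ} {a₀ a₁ a₂ : ℂ} (h : HasJet f t a₀ a₁ a₂) :
    logDeriv f t = a₁ / a₀ := by
  rw [logDeriv_apply, h.hasDerivAt.deriv, h.1]

theorem shiftTerm_eq (p : ℂ) (f : ℤ → ℤ → ℝ → ℂ) (n n₁ : ℤ) (t : ℝ) {a₀ a₁ a₂ b₀ b₁ b₂ : ℂ}
    (ha : HasJet (f n n₁) t a₀ a₁ a₂) (hb : HasJet (f n (n₁ + 1)) t b₀ b₁ b₂)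
    (ha0 : a₀ ≠ 0) (hb0 : b₀ ≠ 0) :
    shiftTerm p f n n₁ t = (a₁ * b₀ - a₀ * b₁ + 2 * p * (a₀ * b₀)) / (a₀ * b₀) := by
  rw [shiftTerm, logDeriv_div t (by rwa [ha.1]) (by rwa [hb.1])
    ha.hasDerivAt.differentiableAt hb.hasDerivAt.differentiableAt, ha.logDeriv, hb.logDeriv]
  field_simp
  ring

theorem logDeriv_shiftTerm (p : ℂ) (f : ℤ → ℤ → ℝ → ℂ) (n n₁ : ℤ) (t : ℝ)
    {a₀ a₁ a₂ b₀ b₁ b₂ : ℂ}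
    (ha : HasJet (f n n₁) t a₀ a₁ a₂) (hb : HasJet (f n (n₁ + 1)) t b₀ b₁ b₂)
    (ha0 : a₀ ≠ 0) (hb0 : b₀ ≠ 0) (hY : a₁ * b₀ - a₀ * b₁ + 2 * p * (a₀ * b₀) ≠ 0) :
    logDeriv (fun s => shiftTerm p f n n₁ s) t
      = (a₂ * b₀ - a₀ * b₂ + 2 * p * (a₁ * b₀ + a₀ * b₁))
          / (a₁ * b₀ - a₀ * b₁ + 2 * p * (a₀ * b₀)) - a₁ / a₀ - b₁ / b₀ := by
  have hsh := shiftTerm_eq p f n n₁ t ha hb ha0 hb0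
  have hda := ha.hasDerivAt
  have hdb := hb.hasDerivAt
  obtain ⟨ha1, a', hae, rfl, ha'⟩ := ha
  obtain ⟨hb1, b', hbe, rfl, hb'⟩ := hb
  have ea : ∀ᶠ s in nhds t, f n n₁ s ≠ 0 :=
    hda.continuousAt.eventually_ne (by rwa [ha1])
  have eb : ∀ᶠ s in nhds t, f n (n₁ + 1) s ≠ 0 :=
    hdb.continuousAt.eventually_ne (by rwa [hb1])
  have hev : (fun s => shiftTerm p f n n₁ s) =ᶠ[nhds t]
      fun s => 2 * p + (a' s / f n n₁ s - b' s / f n (n₁ + 1) s) := by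
    filter_upwards [hae, hbe, ea, eb] with s h1 h2 h3 h4
    rw [shiftTerm, logDeriv_div s h3 h4 h1.differentiableAt h2.differentiableAt,
      logDeriv_apply, logDeriv_apply, h1.deriv, h2.deriv]
  have hd := ((ha'.div hda (by rwa [ha1])).sub (hb'.div hdb (by rwa [hb1]))).const_add (2 * p)
  rw [logDeriv_apply, hev.deriv_eq, hsh]
  have hd' := hd.deriv
  simp only [ha1, hb1] at hd'
  have e1 : deriv (fun s => 2 * p + (a' s / f n n₁ s - b' s / f n (n₁ + 1) s)) t =
      (a₂ * a₀ - a' t * a' t) / a₀ ^ 2 - (b₂ * b₀ - b' t * b' t) / b₀ ^ 2 := hd'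
  rw [e1]
  generalize hYd : a' t * b₀ - a₀ * b' t + 2 * p * (a₀ * b₀) = Y at *
  field_simp
  rw [← hYd]
  ring

/-- Clearing denominators in the equation. -/
theorem tauEquation_iff (p : ℂ) (f : ℤ → ℤ → ℝ → ℂ) (n n₁ : ℤ) (t : ℝ) (v : ℤ → ℤ → ℕ → ℂ)
    (hv : ∀ i e, HasJet (f (n + i) (n₁ + e)) t (v i e 0) (v i e 1) (v i e 2))
    (hdef : EquationDefined p f n n₁ t) :
    TauEquation p f n n₁ t ↔ sextic p v = 0 := by
  have ja := hv 0 0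
  have jb := hv 0 1
  have jc := hv 1 0
  have jd := hv 1 1
  have je := hv (-1) 0
  have jf := hv (-1) 1
  simp only [add_zero, ← sub_eq_add_neg] at ja jb jc jd je jf
  obtain ⟨ha, hc, he, hb, hd, hf, hS, hX, hX'⟩ := hdef
  rw [ja.1] at ha
  rw [jb.1] at hb
  rw [jc.1] at hc
  rw [jd.1] at hd
  rw [je.1] at he
  rw [jf.1] at hf
  rw [shiftTerm_eq p f n n₁ t ja jb ha hb] at hS
  rw [crossTerm, ja.1, jb.1, jc.1, jd.1] at hX
  rw [crossTerm, ja.1, jb.1, je.1, jf.1] at hX'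
  have hL : logDeriv (fun s => f (n + 1) n₁ s * f (n - 1) n₁ s / f n n₁ s ^ 2) t
      = v 1 0 1 / v 1 0 0 + v (-1) 0 1 / v (-1) 0 0 - 2 * (v 0 0 1 / v 0 0 0) := by
    have dc := jc.hasDerivAt.differentiableAt
    have de := je.hasDerivAt.differentiableAt
    have da := ja.hasDerivAt.differentiableAt
    rw [logDeriv_div (f := fun s => f (n + 1) n₁ s * f (n - 1) n₁ s)
        (g := fun s => f n n₁ s ^ 2) t
        (mul_ne_zero (by rwa [jc.1]) (by rwa [je.1])) (pow_ne_zero _ (by rwa [ja.1]))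
        (dc.mul de) (da.pow 2),
      logDeriv_mul t (by rwa [jc.1]) (by rwa [je.1]) dc de, logDeriv_fun_pow da,
      ja.logDeriv, jc.logDeriv, je.logDeriv]
    norm_num
  have hY : v 0 0 1 * v 0 1 0 - v 0 0 0 * v 0 1 1 + 2 * p * (v 0 0 0 * v 0 1 0) ≠ 0 :=
    fun h => hS (by rw [h, zero_div])
  rw [TauEquation, logDeriv_shiftTerm p f n n₁ t ja jb ha hb hY, hL,
    shiftTerm_eq p f n n₁ t ja jb ha hb, shiftTerm_eq p f (n + 1) n₁ t jc jd hc hd,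
    shiftTerm_eq p f (n - 1) n₁ t je jf he hf, crossTerm, crossTerm,
    ja.1, jb.1, jc.1, jd.1, je.1, jf.1]
  unfold sextic
  generalize v 0 0 2 = a2 at *
  generalize v 0 1 2 = b2 at *
  generalize v 0 0 1 = a1 at *
  generalize v 0 1 1 = b1 at *
  generalize v 1 0 1 = c1 at *
  generalize v 1 1 1 = d1 at *
  generalize v (-1) 0 1 = e1 at *
  generalize v (-1) 1 1 = f1 at *
  generalize v 0 0 0 = a at *
  generalize v 0 1 0 = b at *
  generalize v 1 0 0 = c at *
  generalize v 1 1 0 = d at *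
  generalize v (-1) 0 0 = e at *
  generalize v (-1) 1 0 = g at *
  have eX : 1 + b * c / (a * d) = (c * b + d * a) / (a * d) := by field_simp; ring
  have eX' : 1 + b * e / (a * g) = (e * b + g * a) / (a * g) := by field_simp; ring
  rw [eX] at hX
  rw [eX'] at hX'
  have hX1 : c * b + d * a ≠ 0 := fun h => hX (by rw [h, zero_div])
  have hX2 : e * b + g * a ≠ 0 := fun h => hX' (by rw [h, zero_div])
  rw [eX, eX']
  have q1 : (c1 * d - c * d1 + 2 * p * (c * d)) / (c * d) / ((c * b + d * a) / (a * d))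
      = c1 / c - (c1 * b + a * d1 - 2 * p * (a * d)) / (c * b + d * a) := by
    field_simp; ring
  have q2 : (e1 * g - e * f1 + 2 * p * (e * g)) / (e * g) / ((e * b + g * a) / (a * g))
      = e1 / e - (e1 * b + a * f1 - 2 * p * (a * g)) / (e * b + g * a) := by
    field_simp; ring
  have q3 : (a1 * b - a * b1 + 2 * p * (a * b)) / (a * b) = a1 / a - b1 / b + 2 * p := by
    field_simp
  rw [q1, q2, q3]
  generalize hYY : a1 * b - a * b1 + 2 * p * (a * b) = Y at *
  generalize hY2 : a2 * b - a * b2 + 2 * p * (a1 * b + a * b1) = Y' at *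
  generalize hZ : c1 * b + a * d1 - 2 * p * (a * d) = Z at *
  generalize hZ' : e1 * b + a * f1 - 2 * p * (a * g) = Z' at *
  generalize hXX : c * b + d * a = X at *
  generalize hXX' : e * b + g * a = X' at *
  have key : Y' * X * X' - Y * (Z * X' + Z' * X + 2 * p * (X * X'))
      = (Y' / Y - Z / X - Z' / X' - 2 * p) * (Y * X * X') := by
    field_simp; ring
  rw [key, mul_eq_zero, or_iff_left (mul_ne_zero (mul_ne_zero hY hX1) hX2)]
  constructor <;> intro h <;> linear_combination h

theorem hasJet_of_contDiffAt {f : ℝ → ℂ} {t : ℝ} (h : ContDiffAt ℝ 2 f t) :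
    HasJet f t (iteratedDeriv 0 f t) (iteratedDeriv 1 f t) (iteratedDeriv 2 f t) := by
  refine ⟨by rw [iteratedDeriv_zero], deriv f, ?_, by rw [iteratedDeriv_one], ?_⟩
  · filter_upwards [h.eventually (by simp)] with s hs
    exact (hs.differentiableAt (by simp)).hasDerivAt
  · rw [iteratedDeriv_succ, iteratedDeriv_one]
    have h1 : ContDiffAt ℝ 1 (deriv f) t := h.derivWithin (by norm_num)
    exact (h1.differentiableAt (by simp)).hasDerivAt

/-- The polynomial that represents the equation. -/
noncomputable def sexticPoly (p : ℂ) : MvPolynomial (ℤ × ℤ × ℕ) ℂ :=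
  sextic (MvPolynomial.C p) fun i e j => MvPolynomial.X (i, e, j)

theorem eval_sexticPoly (p : ℂ) (v : ℤ × ℤ × ℕ → ℂ) :
    MvPolynomial.eval v (sexticPoly p) = sextic p fun i e j => v (i, e, j) := by
  simp [sexticPoly, sextic]

theorem sexticPoly_isHomogeneous (p : ℂ) : (sexticPoly p).IsHomogeneous 6 := by
  have h2 : (2 * MvPolynomial.C p : MvPolynomial (ℤ × ℤ × ℕ) ℂ) = MvPolynomial.C (2 * p) := by
    rw [MvPolynomial.C_mul]; rfl
  have h0 : ∀ v w : ℤ × ℤ × ℕ, (MvPolynomial.X v * MvPolynomial.X w :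
      MvPolynomial (ℤ × ℤ × ℕ) ℂ).IsHomogeneous 2 := fun v w =>
    (MvPolynomial.isHomogeneous_X ℂ v).mul (MvPolynomial.isHomogeneous_X ℂ w)
  unfold sexticPoly sextic
  simp only [h2]
  have hX := fun i : ℤ => (h0 (i, 0, 0) (0, 1, 0)).add (h0 (i, 1, 0) (0, 0, 0))
  have hZ := fun i : ℤ => ((h0 (i, 0, 1) (0, 1, 0)).add (h0 (0, 0, 0) (i, 1, 1))).sub
    ((h0 (0, 0, 0) (i, 1, 0)).C_mul (2 * p))
  have hY := ((h0 (0, 0, 1) (0, 1, 0)).sub (h0 (0, 0, 0) (0, 1, 1))).add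
    ((h0 (0, 0, 0) (0, 1, 0)).C_mul (2 * p))
  have hY' := ((h0 (0, 0, 2) (0, 1, 0)).sub (h0 (0, 0, 0) (0, 1, 2))).add
    (((h0 (0, 0, 1) (0, 1, 0)).add (h0 (0, 0, 0) (0, 1, 1))).C_mul (2 * p))
  exact ((hY'.mul (hX 1)).mul (hX (-1))).sub (hY.mul ((((hZ 1).mul (hX (-1))).add
    ((hZ (-1)).mul (hX 1))).add (((hX 1).mul (hX (-1))).C_mul (2 * p))))

theorem sexticPoly_isPolynomialForm (p : ℂ) : IsPolynomialForm 2 p (sexticPoly p) := by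
  intro f n n₁ t hf hdef
  rw [eval_sexticPoly]
  exact tauEquation_iff p f n n₁ t _ (fun i e => hasJet_of_contDiffAt (hf _ _)) hdef

/-! ### The equation is not bilinear -/

/-- A polynomial of degree at most two along a line of jets. -/
theorem eval_line_of_isHomogeneous_two {σ : Type*} {Q : MvPolynomial σ ℂ}
    (hQ : Q.IsHomogeneous 2) (a b : σ → ℂ) :
    ∃ q : Polynomial ℂ, q.natDegree ≤ 2 ∧
      ∀ s : ℂ, MvPolynomial.eval (fun i => a i + s * b i) Q = q.eval s := by
  refine ⟨MvPolynomial.aeval (fun i => Polynomial.C (a i) + Polynomial.X * Polynomial.C (b i)) Q,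
    ?_, fun s => ?_⟩
  · refine MvPolynomial.aeval_natDegree_le (m := 2) (n := 1) Q hQ.totalDegree_le _ fun i => ?_
    refine (Polynomial.natDegree_add_le _ _).trans (max_le (by simp) ?_)
    exact Polynomial.natDegree_mul_C_le _ _ |>.trans Polynomial.natDegree_X_le
  · have h : (Polynomial.aeval (R := ℂ) s).comp (MvPolynomial.aeval fun i =>
        Polynomial.C (a i) + Polynomial.X * Polynomial.C (b i))
        = MvPolynomial.aeval fun i => a i + s * b i := by
      ext i
      simp only [AlgHom.comp_apply, MvPolynomial.aeval_X, map_add, map_mul, Polynomial.aeval_C,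
        Polynomial.aeval_X, Algebra.algebraMap_self, RingHom.id_apply]
    have := DFunLike.congr_fun h Q
    rw [AlgHom.comp_apply, Polynomial.coe_aeval_eq_eval] at this
    rw [this, MvPolynomial.aeval_eq_eval]

/-- The point at `s = 0` of a line of jets along which the sextic form is
`(s - 1) (s - 2) (s - 3)`.  The values are chosen such that, in the notation of `sextic`,
`Y = 1`, `Y' = s - 7 + 2 p`, `X = s`, `X' = s + 1`, `Z = 6`, `Z' = -24`. -/
noncomputable def lineBase (p : ℂ) (i e : ℤ) (j : ℕ) : ℂ :=
  if (i, e, j) = (0, 0, 0) then 1 else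
  if (i, e, j) = (0, 0, 1) then 1 - 2 * p else
  if (i, e, j) = (0, 0, 2) then 4 * p ^ 2 - 7 else
  if (i, e, j) = (0, 1, 0) then 1 else
  if (i, e, j) = (1, 0, 0) then 10 else
  if (i, e, j) = (1, 0, 1) then 6 - 20 * p else
  if (i, e, j) = (1, 1, 0) then -10 else
  if (i, e, j) = (-1, 0, 0) then 11 else
  if (i, e, j) = (-1, 0, 1) then -24 - 20 * p else
  if (i, e, j) = (-1, 1, 0) then -10 else 0

/-- The direction of this line of jets. -/
noncomputable def lineDir (i e : ℤ) (j : ℕ) : ℂ :=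
  if (i, e, j) = (0, 0, 2) then 1 else
  if (i, e, j) = (1, 0, 0) then 1 else
  if (i, e, j) = (-1, 0, 0) then 1 else 0

/-- The quadratic polynomial with Taylor coefficients `v` at `0`. -/
noncomputable def jetPoly (v : ℕ → ℂ) (t : ℝ) : ℂ := v 0 + v 1 * t + v 2 * (t ^ 2 / 2)

theorem contDiff_jetPoly (v : ℕ → ℂ) (r : WithTop ℕ∞) : ContDiff ℝ r (jetPoly v) := by
  have h : ContDiff ℝ r (fun t : ℝ => (t : ℂ)) := Complex.ofRealCLM.contDiff
  unfold jetPoly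
  exact (contDiff_const.add (contDiff_const.mul h)).add
    (contDiff_const.mul ((h.pow 2).div_const 2))

theorem hasJet_jetPoly (v : ℕ → ℂ) : HasJet (jetPoly v) 0 (v 0) (v 1) (v 2) := by
  have h : ∀ s : ℝ, HasDerivAt (fun t : ℝ => (t : ℂ)) 1 s := fun s =>
    (hasDerivAt_id s).ofReal_comp
  refine ⟨by simp [jetPoly], fun t => v 1 + v 2 * t, Filter.Eventually.of_forall fun s => ?_,
    by simp, ?_⟩
  · have := (((h s).const_mul (v 1)).const_add (v 0)).add
      (((h s).pow 2).div_const 2 |>.const_mul (v 2))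
    refine this.congr_deriv ?_
    push_cast; ring
  · have := ((h 0).const_mul (v 2)).const_add (v 1)
    simpa using this

theorem iteratedDeriv_jetPoly_line (a b : ℕ → ℂ) (s : ℂ) (j : ℕ) :
    iteratedDeriv j (jetPoly fun l => a l + s * b l) 0
      = iteratedDeriv j (jetPoly a) 0 + s * iteratedDeriv j (jetPoly b) 0 := by
  have h : (jetPoly fun l => a l + s * b l) = jetPoly a + fun t => s * jetPoly b t := by
    funext t
    simp only [jetPoly, Pi.add_apply]; ring
  rw [h, iteratedDeriv_add (contDiff_jetPoly a _).contDiffAt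
    (contDiff_const.mul (contDiff_jetPoly b _)).contDiffAt,
    iteratedDeriv_const_mul s (contDiff_jetPoly b _).contDiffAt]

/-- The restriction of a form of degree two to the line of jets is a polynomial of degree at most
two with the roots `1`, `2`, `3` if the form represents the equation. -/
theorem not_isPolynomialForm_of_isHomogeneous_two (p : ℂ) :
    ¬ ∃ Q : MvPolynomial (ℤ × ℤ × ℕ) ℂ, Q.IsHomogeneous 2 ∧
      IsPolynomialForm ((⊤ : ℕ∞) : WithTop ℕ∞) p Q := by
  rintro ⟨Q, hQ, hform⟩
  let v : ℂ → ℤ → ℤ → ℕ → ℂ := fun s i e j => lineBase p i e j + s * lineDir i e j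
  let f : ℂ → ℤ → ℤ → ℝ → ℂ := fun s i e => jetPoly (v s i e)
  have hjet : ∀ s i e, HasJet (f s (0 + i) (0 + e)) 0 (v s i e 0) (v s i e 1) (v s i e 2) := by
    intro s i e
    rw [zero_add, zero_add]
    exact hasJet_jetPoly _
  have hsextic : ∀ s, sextic p (v s) = (s - 1) * (s - 2) * (s - 3) := by
    intro s
    simp [sextic, v, lineBase, lineDir]
    ring
  obtain ⟨q, hq, hqe⟩ := eval_line_of_isHomogeneous_two hQ
    (fun w => iteratedDeriv w.2.2 (jetPoly (lineBase p w.1 w.2.1)) 0)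
    (fun w => iteratedDeriv w.2.2 (jetPoly (lineDir w.1 w.2.1)) 0)
  have hiff : ∀ s : ℂ, s ≠ 0 → s + 1 ≠ 0 → s + 10 ≠ 0 → s + 11 ≠ 0 →
      ((s - 1) * (s - 2) * (s - 3) = 0 ↔ q.eval s = 0) := by
    intro s h0 h1 h10 h11
    have hval : ∀ i e, f s i e 0 = v s i e 0 := fun i e => (hasJet_jetPoly _).1
    have hdef : EquationDefined p (f s) 0 0 0 := by
      have hsh := shiftTerm_eq p (f s) 0 0 0 (hjet s 0 0) (hjet s 0 1)
        (by simp [v, lineBase, lineDir]) (by simp [v, lineBase, lineDir])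
      constructor
      · simp [hval, v, lineBase, lineDir]
      · rw [hval]; simp [v, lineBase, lineDir]; rwa [add_comm]
      · rw [hval]; simp [v, lineBase, lineDir]; rwa [add_comm]
      · rw [hval]; simp [v, lineBase, lineDir]
      · rw [hval]; simp [v, lineBase, lineDir]
      · rw [hval]; simp [v, lineBase, lineDir]
      · rw [hsh]; simp [v, lineBase, lineDir]
      · rw [crossTerm, hval, hval, hval, hval]
        simp [v, lineBase, lineDir]
        intro h
        apply h0
        field_simp at h
        linear_combination -h
      · rw [crossTerm, hval, hval, hval, hval]
        simp [v, lineBase, lineDir]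
        intro h
        apply h1
        field_simp at h
        linear_combination -h
    have e1 := tauEquation_iff p (f s) 0 0 0 (v s) (hjet s) hdef
    have e2 := hform (f s) 0 0 0 (fun m e => (contDiff_jetPoly _ _).contDiffAt) hdef
    rw [hsextic] at e1
    rw [← e1, e2, ← hqe]
    simp only [zero_add, f, v]
    simp only [iteratedDeriv_jetPoly_line]
  have r1 : q.eval 1 = 0 := (hiff 1 (by norm_num) (by norm_num) (by norm_num) (by norm_num)).1
    (by norm_num)
  have r2 : q.eval 2 = 0 := (hiff 2 (by norm_num) (by norm_num) (by norm_num) (by norm_num)).1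
    (by norm_num)
  have r3 : q.eval 3 = 0 := (hiff 3 (by norm_num) (by norm_num) (by norm_num) (by norm_num)).1
    (by norm_num)
  have hq0 : q = 0 := by
    refine Polynomial.eq_zero_of_natDegree_lt_card_of_eval_eq_zero' q {1, 2, 3} (fun s hs => ?_) ?_
    · simp only [Finset.mem_insert, Finset.mem_singleton] at hs
      rcases hs with rfl | rfl | rfl <;> assumption
    · refine lt_of_le_of_lt hq ?_
      rw [Finset.card_insert_of_notMem (by norm_num), Finset.card_insert_of_notMem (by norm_num),
        Finset.card_singleton]
      norm_num
  -- at `s = 4` the equation is defined but not satisfied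
  have r4 := (hiff 4 (by norm_num) (by norm_num) (by norm_num) (by norm_num)).2
    (by rw [hq0, Polynomial.eval_zero])
  norm_num at r4

/-! ### The determinant of the infinite matrix -/

/-- Multiplying out a finite product of absolutely convergent series. -/
theorem hasSum_pi_prod {𝕜 ι : Type*} [RCLike 𝕜] : ∀ {m : ℕ} (f : Fin m → ι → 𝕜),
    (∀ b, Summable fun i => ‖f b i‖) →
    (Summable fun s : Fin m → ι => ‖∏ b, f b (s b)‖) ∧
      HasSum (fun s : Fin m → ι => ∏ b, f b (s b)) (∏ b, ∑' i, f b i)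
  | 0, f, _ => by
    simp only [Finset.univ_eq_empty, Finset.prod_empty]
    exact ⟨(hasSum_fintype _).summable, by simp⟩
  | m + 1, f, hf => by
    obtain ⟨h1, h2⟩ := hasSum_pi_prod (fun b : Fin m => f b.succ) fun b => hf b.succ
    have h3 := summable_mul_of_summable_norm (hf 0) h1
    have h4 := (hf 0).mul_norm h1
    have e : ∀ q : ι × (Fin m → ι), ∏ b, f b ((Fin.consEquiv fun _ => ι) q b)
        = f 0 q.1 * ∏ b : Fin m, f b.succ (q.2 b) := fun q => by
      rw [Fin.prod_univ_succ]; rfl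
    constructor
    · rw [← (Fin.consEquiv fun _ : Fin (m + 1) => ι).summable_iff]
      refine h4.congr fun q => ?_
      rw [Function.comp_apply, e]
    · rw [← (Fin.consEquiv fun _ : Fin (m + 1) => ι).hasSum_iff, Fin.prod_univ_succ]
      have h5 := (hf 0).of_norm.hasSum.mul h2 h3
      simp only [← e] at h5
      exact h5

/-- Dominated convergence for an unconditional sum whose partial sums of absolute values are
bounded by an integrable function. -/
theorem hasSum_integral_of_sum_norm_le {α ι : Type*} [MeasurableSpace α] {ν : Measure α}
    [Countable ι] {F : ι → α → ℂ} {G : α → ℂ} {g : α → ℝ}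
    (hF : ∀ i, AEStronglyMeasurable (F i) ν) (hg : Integrable g ν)
    (hb : ∀ᵐ a ∂ν, ∀ s : Finset ι, ∑ i ∈ s, ‖F i a‖ ≤ g a)
    (hs : ∀ᵐ a ∂ν, HasSum (fun i => F i a) (G a)) :
    Integrable G ν ∧ HasSum (fun i => ∫ a, F i a ∂ν) (∫ a, G a ∂ν) := by
  have hFi : ∀ i, Integrable (F i) ν := fun i => by
    refine hg.mono' (hF i) ?_
    filter_upwards [hb] with a ha
    simpa using ha {i}
  have hGm : AEStronglyMeasurable G ν :=
    aestronglyMeasurable_of_tendsto_ae (Filter.atTop : Filter (Finset ι))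
      (f := fun s a => ∑ i ∈ s, F i a)
      (fun s => (integrable_finsetSum s fun i _ => hFi i).aestronglyMeasurable) hs
  constructor
  · refine hg.mono' hGm ?_
    filter_upwards [hb, hs] with a h1 h2
    exact le_of_tendsto h2.norm (Filter.Eventually.of_forall fun s =>
      (norm_sum_le _ _).trans (h1 s))
  · have : Filter.Tendsto (fun s : Finset ι => ∫ a, ∑ i ∈ s, F i a ∂ν) Filter.atTop
        (nhds (∫ a, G a ∂ν)) := by
      refine tendsto_integral_filter_of_dominated_convergence g
        (Filter.Eventually.of_forall fun s =>
          (integrable_finsetSum s fun i _ => hFi i).aestronglyMeasurable)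
        (Filter.Eventually.of_forall fun s => ?_) hg hs
      filter_upwards [hb] with a h1
      exact (norm_sum_le _ _).trans (h1 s)
    refine this.congr fun s => ?_
    rw [integral_finsetSum s fun i _ => hFi i]

/-- A sum over tuples of principal minors counts each minor `m!` times, and the tuples with a
repetition contribute zero. -/
theorem hasSum_principalMinors (A : Matrix ℤ ℤ ℂ) (m : ℕ) (d : ℂ)
    (h : HasSum (fun s : Fin m → ℤ => (Matrix.of fun a b => A (s a) (s b)).det) d) :
    HasSum (fun S : {S : Finset ℤ // S.card = m} =>
      (Matrix.of fun i j : {i : ℤ // i ∈ S.val} => A i.val j.val).det)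
      ((1 / (m.factorial : ℂ)) * d) := by
  let g : (Σ S : {S : Finset ℤ // S.card = m}, Fin m ≃ {i : ℤ // i ∈ S.val}) → Fin m → ℤ :=
    fun q a => (q.2 a).1
  have hg : Function.Injective g := by
    rintro ⟨S, e⟩ ⟨S', e'⟩ hq
    have hS : S = S' := by
      apply Subtype.ext
      ext i
      constructor
      · intro hi
        have := congrFun hq (e.symm ⟨i, hi⟩)
        simp only [g, Equiv.apply_symm_apply] at this
        rw [this]
        exact (e' _).2
      · intro hi
        have := congrFun hq (e'.symm ⟨i, hi⟩)
        simp only [g, Equiv.apply_symm_apply] at this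
        rw [← this]
        exact (e _).2
    subst hS
    congr 1
    ext a
    exact congrFun hq a
  have hsupp : ∀ s ∉ Set.range g, (Matrix.of fun a b => A (s a) (s b)).det = 0 := by
    intro s hs
    have hinj : ¬ Function.Injective s := by
      intro hinj
      apply hs
      have hcard : (Finset.univ.image s).card = m := by
        rw [Finset.card_image_of_injective _ hinj, Finset.card_univ, Fintype.card_fin]
      refine ⟨⟨⟨Finset.univ.image s, hcard⟩, Equiv.ofBijective
        (fun a => ⟨s a, Finset.mem_image_of_mem s (Finset.mem_univ a)⟩) ⟨fun a b hab => ?_,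
          fun i => ?_⟩⟩, rfl⟩
      · exact hinj (congrArg Subtype.val hab)
      · obtain ⟨a, _, ha⟩ := Finset.mem_image.1 i.2
        exact ⟨a, Subtype.ext ha⟩
    obtain ⟨a, b, hab, hne⟩ : ∃ a b, s a = s b ∧ a ≠ b := by
      simpa [Function.Injective] using hinj
    refine Matrix.det_zero_of_row_eq hne ?_
    ext c
    simp [hab]
  -- injective tuples, grouped by their image
  have h1 := ((hg.hasSum_iff hsupp).2 h).sigma (g := fun S =>
    (m.factorial : ℂ) * (Matrix.of fun i j : {i : ℤ // i ∈ S.val} => A i.val j.val).det) (by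
      rintro ⟨S, hS⟩
      have hc : Fintype.card (Fin m ≃ {i : ℤ // i ∈ S}) = m.factorial := by
        rw [Fintype.card_equiv (Fintype.equivFinOfCardEq (by simpa using hS)).symm,
          Fintype.card_fin]
      have h2 := hasSum_fintype fun e : Fin m ≃ {i : ℤ // i ∈ S} =>
        (Matrix.of fun a b => A (g ⟨⟨S, hS⟩, e⟩ a) (g ⟨⟨S, hS⟩, e⟩ b)).det
      have h3 : ∀ e : Fin m ≃ {i : ℤ // i ∈ S},
          (Matrix.of fun a b => A (g ⟨⟨S, hS⟩, e⟩ a) (g ⟨⟨S, hS⟩, e⟩ b)).det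
          = (Matrix.of fun i j : {i : ℤ // i ∈ S} => A i.val j.val).det := fun e => by
        rw [← Matrix.det_submatrix_equiv_self e]; rfl
      simp only [h3] at h2
      rw [Finset.sum_const, Finset.card_univ, hc, nsmul_eq_mul] at h2
      simpa only [Function.comp_def, h3] using h2)
  have h0 : (m.factorial : ℂ) ≠ 0 := Nat.cast_ne_zero.2 (Nat.factorial_ne_zero _)
  simpa only [← mul_assoc, one_div_mul_cancel h0, one_mul]
    using h1.mul_left (1 / (m.factorial : ℂ))

/-- The component `∑_l Ω_{il} k^l` of the infinite vector `Ω c(k)`. -/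
noncomputable def rowSum (Om : Matrix ℤ ℤ ℂ) (i : ℤ) (k : ℂ) : ℂ := ∑' l : ℤ, Om i l * k ^ l

/-- Summing the double series for the Cauchy kernel by rows. -/
theorem IsCauchyMatrix.exists_bound {Z : SpectralMeasure} {Om : Matrix ℤ ℤ ℂ}
    (h : IsCauchyMatrix Z Om) : ∃ M : ℝ, ∀ z ∈ Z.domain, ∀ z' ∈ Z.domain,
      (∀ i, Summable fun l => ‖z'.2 ^ i * Om i l * z.1 ^ l‖) ∧
      (∀ i (s : Finset ℤ), ∑ l ∈ s, ‖z'.2 ^ i * Om i l * z.1 ^ l‖ ≤ M) ∧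
      (Summable fun i => ‖rowSum Om i z.1 * z'.2 ^ i‖) ∧
      ∑' i, ‖rowSum Om i z.1 * z'.2 ^ i‖ ≤ M ∧
      ∑' i, rowSum Om i z.1 * z'.2 ^ i = kernel z.1 z'.2 := by
  obtain ⟨M, hM⟩ := h
  refine ⟨M, fun z hz z' hz' => ?_⟩
  obtain ⟨hs, hle, heq⟩ := hM z hz z' hz'
  have hrow : ∀ i, Summable fun l => ‖z'.2 ^ i * Om i l * z.1 ^ l‖ := fun i => hs.prod_factor i
  have htot : ∀ i, ∑' l, ‖z'.2 ^ i * Om i l * z.1 ^ l‖ ≤ M := fun i => by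
    refine le_trans ?_ hle
    rw [hs.tsum_prod]
    exact hs.prod.le_tsum i fun _ _ => tsum_nonneg fun _ => norm_nonneg _
  have hu : ∀ i, rowSum Om i z.1 * z'.2 ^ i = ∑' l, z'.2 ^ i * Om i l * z.1 ^ l := fun i => by
    simp only [rowSum, mul_assoc, tsum_mul_left]
    ring
  have hnorm : ∀ i, ‖rowSum Om i z.1 * z'.2 ^ i‖ ≤ ∑' l, ‖z'.2 ^ i * Om i l * z.1 ^ l‖ :=
    fun i => by
      rw [hu]
      exact norm_tsum_le_tsum_norm (hrow i)
  have hsn : Summable fun i => ‖rowSum Om i z.1 * z'.2 ^ i‖ :=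
    Summable.of_nonneg_of_le (fun _ => norm_nonneg _) hnorm hs.prod
  refine ⟨hrow, fun i s => ((hrow i).sum_le_tsum s fun _ _ => norm_nonneg _).trans (htot i),
    hsn, ?_, ?_⟩
  · refine (hsn.tsum_le_tsum hnorm hs.prod).trans ?_
    rwa [← hs.tsum_prod]
  · rw [← heq, hs.of_norm.tsum_prod]
    exact tsum_congr hu

/-- The product of the plane wave factors and the density. -/
noncomputable def waveDensity (Z : SpectralMeasure) (p : ℕ → ℂ) (x : ℕ → ℝ) (N : ℕ → ℤ) (n : ℤ)
    (z : ℂ × ℂ) : ℂ :=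
  rho p x N n z.1 * sigma p x N n z.2 * Z.density z

/-- The entries of `Ω C_n` are obtained by exchanging sum and integral. -/
theorem infMul_CMat_eq {Z : SpectralMeasure} {p : ℕ → ℂ} {x : ℕ → ℝ} {N : ℕ → ℤ} {n : ℤ}
    {Om : Matrix ℤ ℤ ℂ} (hD : MeasurableSet Z.domain) (hne : ∀ z ∈ Z.domain, z.2 ≠ 0)
    (hOm : IsCauchyMatrix Z Om) (hC : CMatConverges Z p x N n) (i j : ℤ) :
    Integrable (fun z => waveDensity Z p x N n z * (rowSum Om i z.1 * z.2 ^ j))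
      (Z.base.restrict Z.domain) ∧
    infMul Om (CMat Z p x N n) i j = ∫ z in Z.domain,
      waveDensity Z p x N n z * (rowSum Om i z.1 * z.2 ^ j) ∂Z.base := by
  obtain ⟨M, hM⟩ := hOm.exists_bound
  have hmem : ∀ᵐ z ∂(Z.base.restrict Z.domain), z ∈ Z.domain := ae_restrict_mem hD
  -- the series is dominated by the entry of `C_n` with exponents `0` and `j - i`
  have key := hasSum_integral_of_sum_norm_le (ν := Z.base.restrict Z.domain)
    (F := fun l z => Om i l *
      (rho p x N n z.1 * z.1 ^ l * z.2 ^ j * sigma p x N n z.2 * Z.density z))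
    (G := fun z => waveDensity Z p x N n z * (rowSum Om i z.1 * z.2 ^ j))
    (g := fun z => M *
      ‖rho p x N n z.1 * z.1 ^ (0 : ℤ) * z.2 ^ (j - i) * sigma p x N n z.2 * Z.density z‖)
    (fun l => ((hC l j).const_mul (Om i l)).aestronglyMeasurable)
    ((hC 0 (j - i)).norm.const_mul M) (by
      filter_upwards [hmem] with z hz s
      refine le_trans (le_of_eq ?_) (mul_le_mul_of_nonneg_right ((hM z hz z hz).2.1 i s)
        (norm_nonneg _))
      rw [Finset.sum_mul]
      refine Finset.sum_congr rfl fun l _ => ?_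
      rw [← norm_mul]
      congr 1
      have e : z.2 ^ j = z.2 ^ i * z.2 ^ (j - i) := by
        rw [← zpow_add₀ (hne z hz), add_sub_cancel]
      rw [e, zpow_zero]
      ring) (by
      filter_upwards [hmem] with z hz
      have h0 : z.2 ^ i ≠ 0 := zpow_ne_zero _ (hne z hz)
      have hs : Summable fun l => Om i l * z.1 ^ l := by
        have := ((hM z hz z hz).1 i).of_norm.mul_left (z.2 ^ i)⁻¹
        simpa only [mul_assoc, inv_mul_cancel_left₀ h0] using this
      have := hs.hasSum.mul_left (waveDensity Z p x N n z * z.2 ^ j)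
      rw [waveDensity] at this ⊢
      convert this using 1
      · rfl
      · funext l; ring
      · rw [show rowSum Om i z.1 = ∑' l, Om i l * z.1 ^ l from rfl]; ring)
  refine ⟨key.1, ?_⟩
  rw [← key.2.tsum_eq]
  simp only [infMul, CMat, integral_const_mul]

/-- The sum over all `m`-tuples of indices of the contributions of one permutation to the
determinants `det [(Ω C_n)_{s_a s_b}]`. -/
theorem hasSum_integral_perm {Z : SpectralMeasure} [SigmaFinite Z.base] {p : ℕ → ℂ} {x : ℕ → ℝ}
    {N : ℕ → ℤ} {n : ℤ} {Om : Matrix ℤ ℤ ℂ} (hD : MeasurableSet Z.domain)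
    (hne : ∀ z ∈ Z.domain, z.2 ≠ 0)
    (hOm : IsCauchyMatrix Z Om) (hC : CMatConverges Z p x N n) {m : ℕ}
    (τ : Equiv.Perm (Fin m)) :
    Integrable (fun z : Fin m → ℂ × ℂ => (∏ b, waveDensity Z p x N n (z b)) *
      ∏ b, kernel (z b).1 (z (τ b)).2) (baseProd Z m) ∧
    HasSum (fun s : Fin m → ℤ => ∏ b, infMul Om (CMat Z p x N n) (s (τ b)) (s b))
      (∫ z, (∏ b, waveDensity Z p x N n (z b)) * ∏ b, kernel (z b).1 (z (τ b)).2
        ∂(baseProd Z m)) := by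
  obtain ⟨M, hM⟩ := hOm.exists_bound
  have hω : Integrable (waveDensity Z p x N n) (Z.base.restrict Z.domain) := by
    have := hC 0 0
    simp only [zpow_zero, mul_one] at this
    exact this
  have hc := infMul_CMat_eq hD hne hOm hC
  have hint : ∀ s : Fin m → ℤ, Integrable (fun z : Fin m → ℂ × ℂ => ∏ b,
      (waveDensity Z p x N n (z b) * (rowSum Om (s (τ b)) (z b).1 * (z b).2 ^ s b)))
      (baseProd Z m) := fun s => Integrable.fintype_prod fun b => (hc (s (τ b)) (s b)).1
  have hreindex : ∀ (s : Fin m → ℤ) (z : Fin m → ℂ × ℂ), ∏ b,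
      (waveDensity Z p x N n (z b) * (rowSum Om (s (τ b)) (z b).1 * (z b).2 ^ s b))
      = (∏ b, waveDensity Z p x N n (z b)) *
        ∏ b, (rowSum Om (s b) (z (τ.symm b)).1 * (z b).2 ^ s b) := fun s z => by
    rw [Finset.prod_mul_distrib, Finset.prod_mul_distrib, Finset.prod_mul_distrib,
      ← Equiv.prod_comp τ fun b => rowSum Om (s b) (z (τ.symm b)).1]
    simp only [Equiv.symm_apply_apply]
  have hkernel : ∀ z : Fin m → ℂ × ℂ, ∏ b, kernel (z b).1 (z (τ b)).2
      = ∏ b, kernel (z (τ.symm b)).1 (z b).2 := fun z => by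
    rw [← Equiv.prod_comp τ fun b => kernel (z (τ.symm b)).1 (z b).2]
    simp only [Equiv.symm_apply_apply]
  -- for fixed points the sum over the tuples is a product of series for the kernel, each of which
  -- is absolutely bounded by `M`
  have key := hasSum_integral_of_sum_norm_le (ν := baseProd Z m)
    (F := fun (s : Fin m → ℤ) z => ∏ b,
      (waveDensity Z p x N n (z b) * (rowSum Om (s (τ b)) (z b).1 * (z b).2 ^ s b)))
    (G := fun z => (∏ b, waveDensity Z p x N n (z b)) * ∏ b, kernel (z b).1 (z (τ b)).2)
    (g := fun z => (∏ b, ‖waveDensity Z p x N n (z b)‖) * M ^ m)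
    (fun s => (hint s).aestronglyMeasurable)
    ((Integrable.fintype_prod fun _ : Fin m => hω.norm).mul_const _) (by
      filter_upwards [ae_forall_mem_pi Z.base hD m] with z hz T
      have h1 : ∀ b, Summable fun i => ‖rowSum Om i (z (τ.symm b)).1 * (z b).2 ^ i‖ := fun b =>
        (hM _ (hz _) _ (hz b)).2.2.1
      have h2 := hasSum_pi_prod (fun b i => ‖rowSum Om i (z (τ.symm b)).1 * (z b).2 ^ i‖)
        fun b => by simpa only [norm_norm] using h1 b
      simp only [hreindex, norm_mul (∏ b, waveDensity Z p x N n (z b)), norm_prod]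
      rw [← Finset.mul_sum]
      refine mul_le_mul_of_nonneg_left ?_ (Finset.prod_nonneg fun _ _ => norm_nonneg _)
      refine (sum_le_hasSum T (fun s _ => Finset.prod_nonneg fun _ _ => norm_nonneg _)
        h2.2).trans ?_
      refine (Finset.prod_le_prod (fun b _ => tsum_nonneg fun _ => norm_nonneg _)
        fun b _ => (hM _ (hz (τ.symm b)) _ (hz b)).2.2.2.1).trans ?_
      simp) (by
      filter_upwards [ae_forall_mem_pi Z.base hD m] with z hz
      have h2 := hasSum_pi_prod (fun b i => rowSum Om i (z (τ.symm b)).1 * (z b).2 ^ i)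
        fun b => (hM _ (hz _) _ (hz b)).2.2.1
      simp only [hreindex, hkernel]
      refine HasSum.mul_left _ ?_
      rw [← Finset.prod_congr rfl fun b _ => (hM _ (hz (τ.symm b)) _ (hz b)).2.2.2.2]
      exact h2.2)
  refine ⟨key.1, ?_⟩
  convert key.2 using 2 with s
  rw [baseProd, integral_fintype_prod_eq_prod (fun b (w : ℂ × ℂ) =>
    waveDensity Z p x N n w * (rowSum Om (s (τ b)) w.1 * w.2 ^ s b))]
  exact Finset.prod_congr rfl fun b _ => (hc _ _).2

/-- The sum over all `m`-tuples of indices of the minors of `Ω C_n`. -/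
theorem hasSum_minors_infMul {Z : SpectralMeasure} [SigmaFinite Z.base] {p : ℕ → ℂ} {x : ℕ → ℝ}
    {N : ℕ → ℤ} {n : ℤ} {Om : Matrix ℤ ℤ ℂ} (hD : MeasurableSet Z.domain)
    (hne : ∀ z ∈ Z.domain, z.2 ≠ 0)
    (hOm : IsCauchyMatrix Z Om) (hC : CMatConverges Z p x N n) (m : ℕ) :
    HasSum (fun s : Fin m → ℤ =>
      (Matrix.of fun a b => infMul Om (CMat Z p x N n) (s a) (s b)).det)
      (∫ z, tauIntegrand Z p x N n m z ∂(baseProd Z m)) := by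
  have h := fun τ : Equiv.Perm (Fin m) => hasSum_integral_perm (m := m) hD hne hOm hC τ
  have hsum := hasSum_sum (s := Finset.univ) fun (τ : Equiv.Perm (Fin m)) _ =>
    (h τ).2.mul_left ((Equiv.Perm.sign τ : ℤ) : ℂ)
  convert hsum using 1
  · rfl
  · funext s
    rw [Matrix.det_apply']
    rfl
  · simp only [← integral_const_mul]
    rw [← integral_finsetSum _ fun τ _ => (h τ).1.const_mul _]
    refine integral_congr_ae (Filter.Eventually.of_forall fun z => ?_)
    simp only [tauIntegrand]
    rw [← Matrix.det_transpose, Matrix.det_apply', Finset.mul_sum]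
    refine Finset.sum_congr rfl fun τ _ => ?_
    simp only [Matrix.transpose_apply, Matrix.of_apply, waveDensity]
    ring

theorem tauJet_zero (Z : SpectralMeasure) (p : ℕ → ℂ) (x : ℕ → ℝ) (N : ℕ → ℤ) (n n₁ : ℤ) :
    tauJet Z p x N n n₁ 0 = tauFun Z p x N n n₁ := by
  funext t
  simp only [tauJet, tauFun, tau, pow_zero, one_mul]

theorem hasDetOneAdd_tauFun {Z : SpectralMeasure} [SigmaFinite Z.base] {p : ℕ → ℂ} {x : ℕ → ℝ}
    {N : ℕ → ℤ} (hreg : Regular Z p x N) {n n₁ : ℤ} {t : ℝ}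
    (hconv : TauConverges Z p (Function.update x 0 t) (Function.update N 0 n₁) n)
    {Om : Matrix ℤ ℤ ℂ} (hOm : IsCauchyMatrix Z Om)
    (hC : CMatConverges Z p (Function.update x 0 t) (Function.update N 0 n₁) n) :
    HasDetOneAdd (infMul Om (CMat Z p (Function.update x 0 t) (Function.update N 0 n₁) n))
      (tauFun Z p x N n n₁ t) := by
  refine ⟨_, fun m => hasSum_principalMinors _ m _ (hasSum_minors_infMul hreg.measurable_domain
    (fun z hz => (hreg.ne_zero z hz).2) hOm hC m), ?_⟩
  have h := hasConfigInt_jetFam Z p x N n n₁ t hconv 0 (by norm_num)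
  have hs := h.summable_norm.of_norm.hasSum
  rw [h.tsum_eq, tauJet_zero] at hs
  simp only [configInt, ← tauIntegrand_eq, pow_zero, one_mul] at hs
  exact hs

/-! ### Smoothness of the tau function and its equation -/

theorem contDiffOn_tauFun (Z : SpectralMeasure) [SigmaFinite Z.base] (p : ℕ → ℂ) (x : ℕ → ℝ)
    (N : ℕ → ℤ) (hreg : Regular Z p x N) (J : Set ℝ) (hJ : IsOpen J) (n n₁ : ℤ)
    (hconv : ∀ t ∈ J, TauConverges Z p (Function.update x 0 t) (Function.update N 0 n₁) n) :
    ContDiffOn ℝ 2 (tauFun Z p x N n n₁) J := by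
  obtain ⟨h, h2⟩ := tauJet_smooth Z p x N hreg J hJ n n₁ hconv
  rw [← tauJet_zero]
  have hd : ∀ j < 2, ContDiffOn ℝ ((1 - j : ℕ) : ℕ) (tauJet Z p x N n n₁ (j + 1)) J →
      ContDiffOn ℝ ((1 - j : ℕ) + 1) (tauJet Z p x N n n₁ j) J := fun j hj hc => by
    rw [contDiffOn_succ_iff_deriv_of_isOpen hJ]
    exact ⟨fun t ht => (h j hj t ht).differentiableAt.differentiableWithinAt, by simp,
      hc.congr fun t ht => (h j hj t ht).deriv⟩
  have h1 := hd 1 (by norm_num) (contDiffOn_zero.2 h2)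
  have h0 := hd 0 (by norm_num) (by simpa using h1)
  norm_num at h0
  exact h0

theorem tauEquation_tauFun (Z : SpectralMeasure) [SigmaFinite Z.base] (p : ℕ → ℂ) (x : ℕ → ℝ)
    (N : ℕ → ℤ) (hreg : Regular Z p x N) (J : Set ℝ) (hJ : IsOpen J)
    (hconv : ∀ t ∈ J, ∀ n n₁ : ℤ,
      TauConverges Z p (Function.update x 0 t) (Function.update N 0 n₁) n)
    (t : ℝ) (ht : t ∈ J) (n n₁ : ℤ) (hdef : EquationDefined (p 0) (tauFun Z p x N) n n₁ t) :
    TauEquation (p 0) (tauFun Z p x N) n n₁ t := by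
  refine (tauEquation_iff (p 0) (tauFun Z p x N) n n₁ t
    (fun i e j => tauJet Z p x N (n + i) (n₁ + e) j t) (fun i e => ?_) hdef).2
    (sextic_tauJet Z p x N hreg t (hconv t ht) n n₁)
  obtain ⟨h, -⟩ := tauJet_smooth Z p x N hreg J hJ (n + i) (n₁ + e) fun s hs => hconv s hs _ _
  rw [← tauJet_zero]
  exact ⟨rfl, _, Filter.eventually_of_mem (hJ.mem_nhds ht) (h 0 (by norm_num)), rfl,
    h 1 (by norm_num) t ht⟩

end DL

theorem mainTheorem1
    (Z : DL.SpectralMeasure) [MeasureTheory.SigmaFinite Z.base]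
    (p : ℕ → ℂ) (x : ℕ → ℝ) (N : ℕ → ℤ) (hreg : DL.Regular Z p x N)
    (J : Set ℝ) (hJ : IsOpen J)
    (hconv : ∀ t ∈ J, ∀ n n₁ : ℤ,
      DL.TauConverges Z p (Function.update x 0 t) (Function.update N 0 n₁) n) :
    -- the tau function is the determinant of the infinite matrix
    (∀ Om : Matrix ℤ ℤ ℂ, DL.IsCauchyMatrix Z Om → ∀ t ∈ J, ∀ n n₁ : ℤ,
      DL.CMatConverges Z p (Function.update x 0 t) (Function.update N 0 n₁) n →
      DL.HasDetOneAdd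
        (DL.infMul Om (DL.CMat Z p (Function.update x 0 t) (Function.update N 0 n₁) n))
        (DL.tauFun Z p x N n n₁ t)) ∧
    -- it is twice continuously differentiable in `x_1`
    (∀ n n₁ : ℤ, ContDiffOn ℝ 2 (DL.tauFun Z p x N n n₁) J) ∧
    -- it solves the equation
    (∀ t ∈ J, ∀ n n₁ : ℤ, DL.EquationDefined (p 0) (DL.tauFun Z p x N) n n₁ t →
      DL.TauEquation (p 0) (DL.tauFun Z p x N) n n₁ t) ∧
    -- the equation is homogeneous of degree 6 and not bilinear
    (∃ P : MvPolynomial (ℤ × ℤ × ℕ) ℂ, P.IsHomogeneous 6 ∧ DL.IsPolynomialForm 2 (p 0) P) ∧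
    (¬ ∃ Q : MvPolynomial (ℤ × ℤ × ℕ) ℂ, Q.IsHomogeneous 2 ∧
      DL.IsPolynomialForm ((⊤ : ℕ∞) : WithTop ℕ∞) (p 0) Q) := by
  refine ⟨fun Om hOm t ht n n₁ hC =>
      DL.hasDetOneAdd_tauFun hreg (hconv t ht n n₁) hOm hC,
    fun n n₁ => DL.contDiffOn_tauFun Z p x N hreg J hJ n n₁ fun t ht => hconv t ht n n₁,
    fun t ht n n₁ hdef => DL.tauEquation_tauFun Z p x N hreg J hJ hconv t ht n n₁ hdef,
    ⟨DL.sexticPoly (p 0), DL.sexticPoly_isHomogeneous _, DL.sexticPoly_isPolynomialForm _⟩,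
    DL.not_isPolynomialForm_of_isHomogeneous_two (p 0)⟩
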